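/- Let $h$ be the absolute logarithmic Weil height on $\overline{\mathbb{Q}}$, extended to $\mathbb{P}^1(\overline{\mathbb{Q}})$ by $h([x:y])=h(x/y)$ for $y\neq 0$ and $h([1:0])=0$. For a quadratic morphism $f:\mathbb{P}^1\to\mathbb{P}^1$ over $\overline{\mathbb{Q}}$ (a rational function of degree exactly $2$), let \[\hat{h}_f(P)=\lim_{n\to\infty}\frac{h(f^n(P))}{2^n},\qquad \hat{h}_{\mathrm{crit}}(f)=\sum_{P\in\mathbb{P}^1(\overline{\mathbb{Q}})}(e_P(f)-1)\,\hat{h}_f(P)\] be the canonical height and the critical height of $f$, where $e_P(f)$ is the ramification index of $f$ at $P$. The critical height is invariant under change of coordinates, and so it is a function on the moduli space $\mathsf{M}_2$ of conjugacy classes, under the action of $\operatorname{PGL}_2(\overline{\mathbb{Q}})$, of quadratic morphisms over $\overline{\mathbb{Q}}$. For $\lambda\in\overline{\mathbb{Q}}$, let $\operatorname{Per}_1(\lambda)\subseteq\mathsf{M}_2$ be the set of conjugacy classes of quadratic morphisms with a fixed point of multiplier $\lambda$. If \[\inf_{f\in\operatorname{Per}_1(\lambda)}\hat{h}_{\mathrm{crit}}(f)=0,\]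 then $h(\lambda)\leq\log 12$. -/

import Mathlib

open scoped LinearAlgebra.Projectivization MatrixGroups

noncomputable section

/-- The field of algebraic numbers. -/
abbrev Qbar : Type := AlgebraicClosure ℚ

/-- The projective line over `K`. -/
abbrev ProjLine (K : Type*) [Field K] : Type _ := ℙ K (Fin 2 → K)

/-- The absolute logarithmic Weil height on the projective line over the algebraic numbers:
`[x : y]` has the absolute logarithmic height of the algebraic number `x / y` if `y ≠ 0`, and
the point at infinity `[1 : 0]` has height `0`. -/
def weilHeight (P : ProjLine Qbar) : ℝ :=
  letI := Classical.decEq Qbar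
  ((OnePoint.equivProjectivization Qbar).symm P).elim 0 NumberField.absLogHeight₁

/-- A homogeneous lift of a rational function of degree `d` over an algebraically closed field:
a pair of binary forms `F = (F₀, F₁)` of degree `d` without a common zero on the projective line.
The rational function is `z ↦ F₀(z, 1) / F₁(z, 1)`. -/
structure RatMap (K : Type*) [Field K] (d : ℕ) where
  form : Fin 2 → MvPolynomial (Fin 2) K
  homogeneous : ∀ i, (form i).IsHomogeneous d
  noCommonZero : ∀ x : Fin 2 → K, x ≠ 0 → ∃ i, MvPolynomial.eval x (form i) ≠ 0

namespace RatMap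

variable {K : Type*} [Field K] {d : ℕ}

/-- The polynomial map of the plane given by the two forms. -/
def lift (f : RatMap K d) (x : Fin 2 → K) : Fin 2 → K :=
  fun i => MvPolynomial.eval x (f.form i)

theorem lift_ne_zero (f : RatMap K d) {x : Fin 2 → K} (hx : x ≠ 0) : f.lift x ≠ 0 := by
  obtain ⟨i, hi⟩ := f.noCommonZero x hx
  exact fun h => hi (congrFun h i)

theorem lift_smul (f : RatMap K d) (t : K) (x : Fin 2 → K) :
    f.lift (t • x) = t ^ d • f.lift x := by
  funext i
  simp only [lift, Pi.smul_apply, smul_eq_mul, MvPolynomial.eval_eq, Finset.mul_sum]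
  refine Finset.sum_congr rfl fun m hm => ?_
  have h : m.degree = d := by
    rw [Finsupp.degree_eq_weight_one]
    exact f.homogeneous i (MvPolynomial.mem_support_iff.mp hm)
  simp only [mul_pow, Finset.prod_mul_distrib, Finset.prod_pow_eq_pow_sum]
  rw [show ∑ j ∈ m.support, m j = d from h]
  ring

/-- The morphism of the projective line `[x] ↦ [F(x)]`. -/
def map (f : RatMap K d) : ProjLine K → ProjLine K :=
  Projectivization.lift
    (fun x : {x : Fin 2 → K // x ≠ 0} => Projectivization.mk K (f.lift x.1) (f.lift_ne_zero x.2))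
    (by
      rintro ⟨a, ha⟩ ⟨b, hb⟩ t h
      refine (Projectivization.mk_eq_mk_iff' K _ _ _ _).mpr ⟨t ^ d, ?_⟩
      dsimp only at h ⊢
      rw [h, f.lift_smul])

/-- The differential of the polynomial map of the plane at `x`, applied to `v`. -/
def diff (f : RatMap K d) (x v : Fin 2 → K) : Fin 2 → K :=
  fun i => ∑ j, MvPolynomial.eval x (MvPolynomial.pderiv j (f.form i)) * v j

/-- `P` is a fixed point of `f` with multiplier `lam`. Write `P = [x]`, so that `F(x) = c x`,
and take `s ↦ [x + s v]` as a local parameter at `P = [x]`, where `x`, `v` is a basis of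
the plane. If `dF(x) v = b v + t x`, then `F(x + s v) = (c + O(s)) x + (b s + O(s ^ 2)) v`,
so in this parameter the map is `s ↦ (b / c) s + O(s ^ 2)`, and the multiplier is `b / c`. -/
def IsFixedPointWithMultiplier (f : RatMap K d) (P : ProjLine K) (lam : K) : Prop :=
  ∃ (x : Fin 2 → K) (hx : x ≠ 0) (v : Fin 2 → K) (c t : K),
    P = Projectivization.mk K x hx ∧ LinearIndependent K ![x, v] ∧
      f.lift x = c • x ∧ f.diff x v = (lam * c) • v + t • x

/-- The linear form `x₁ X₀ - x₀ X₁`, a homogeneous local equation of the point `[x₀ : x₁]`. -/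
def linForm (x : Fin 2 → K) : MvPolynomial (Fin 2) K :=
  MvPolynomial.C (x 1) * MvPolynomial.X 0 - MvPolynomial.C (x 0) * MvPolynomial.X 1

/-- The ramification index `e_P(f)`: the order of vanishing at `P` of the pull-back
under `f` of the linear form that vanishes at `f(P)`. -/
def ramificationIndex (f : RatMap K d) (P : ProjLine K) : ℕ :=
  multiplicity (linForm P.rep)
    (MvPolynomial.C (f.lift P.rep 1) * f.form 0 - MvPolynomial.C (f.lift P.rep 0) * f.form 1)

/-- Two rational functions are conjugate if a change of coordinate on the projective line takes
the one to the other. Two lifts of the same rational function are conjugate by the identity. -/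
def IsConj (f g : RatMap K d) : Prop :=
  ∃ A : GL (Fin 2) K, ∀ P : ProjLine K, A • g.map P = f.map (A • P)

variable (K d) in
/-- Conjugacy of rational functions of degree `d`. -/
def conjSetoid : Setoid (RatMap K d) where
  r := IsConj
  iseqv :=
    { refl := fun f => ⟨1, fun P => by simp⟩
      symm := by
        rintro f g ⟨A, hA⟩
        refine ⟨A⁻¹, fun P => ?_⟩
        rw [inv_smul_eq_iff, hA, smul_inv_smul]
      trans := by
        rintro f g h ⟨A, hA⟩ ⟨B, hB⟩
        refine ⟨A * B, fun P => ?_⟩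
        rw [mul_smul, hB, hA, mul_smul] }

/-- The canonical height `lim h(f ^ n (P)) / d ^ n` associated to `f`. -/
def canonicalHeight (f : RatMap Qbar d) (P : ProjLine Qbar) : ℝ :=
  Filter.limUnder Filter.atTop (fun n : ℕ => weilHeight (f.map^[n] P) / (d : ℝ) ^ n)

/-- The critical height: the sum of the canonical heights of the critical points of `f`, each
counted with its multiplicity `e_P(f) - 1`. -/
def critHeight (f : RatMap Qbar d) : ℝ :=
  ∑ᶠ P : ProjLine Qbar, ((f.ramificationIndex P : ℝ) - 1) * f.canonicalHeight P

end RatMap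

/-- The moduli space of rational functions of degree `d`: conjugacy classes under change of
coordinate (over an algebraically closed field, these are the points of the quotient variety). -/
def ModuliSpace (K : Type*) [Field K] (d : ℕ) : Type _ := Quotient (RatMap.conjSetoid K d)

/-- The conjugacy class of a rational function. -/
def ModuliSpace.mk {K : Type*} [Field K] {d : ℕ} (f : RatMap K d) : ModuliSpace K d :=
  Quotient.mk (RatMap.conjSetoid K d) f

/-- The locus `Per₁(lam)` in the moduli space: the conjugacy classes of the rational functions
of degree `d` that have a fixed point of multiplier `lam`. -/
def PerOne {K : Type*} [Field K] (d : ℕ) (lam : K) : Set (ModuliSpace K d) :=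
  {m | ∃ f : RatMap K d, ModuliSpace.mk f = m ∧
    ∃ P : ProjLine K, f.IsFixedPointWithMultiplier P lam}

/-- The set of values of the critical height on the locus `Per₁(lam)` in the moduli space of
quadratic morphisms over the algebraic numbers. -/
def critHeightValues (lam : Qbar) : Set ℝ :=
  {r | ∃ f : RatMap Qbar 2, ModuliSpace.mk f ∈ PerOne 2 lam ∧ f.critHeight = r}

end

/-! The cases `λ = 0` and `λ = 1` are trivial. Otherwise there is a second fixed point, and placing
the two at `∞` and `0` turns the map into `f(w) = w (w + μ) / (1 + λ w)` with `λ μ ≠ 1`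
(`exists_isConj_normalForm`). Here `∞` has multiplier `λ`, the critical points satisfy `w₁ + w₂ = -2
/ λ` and `w₁ w₂ = μ / λ`, and `f(wᵢ) = -wᵢ²`.

At a place where `λ` is small, `∞` is strongly attracting. The larger critical point has size at
least `|2 / λ|`, up to a factor 2 at archimedean places, so its critical value already lies where
`f` multiplies sizes by about `1 / |λ|`. Each further iterate gains `log (1 / |λ|)`, with a loss of
at most `log 3` at archimedean places and `log⁺ |1/4|` at the others. Summing over all places gives
`N (h(λ) - log 12) ≤ h(f^(N+1)(w₁)) + h(f^(N+1)(w₂))`, where `12 = 3 · 4`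
(`NumberField.mul_absLogHeight₁_le`).

Tate's argument bounds the right side by `2^(N+1) ĥ_crit(f) + 2C` with `C = 5 (h(λ) + h(μ)) + 4 log
2`. Exchanging the two fixed points gives the same bound for `μ`. As `ĥ_crit` tends to 0, `μ` and
hence `C` may vary; but the bound for `μ` at one fixed `N > 10` keeps `h(μ)` bounded, and then the
bound for `λ` with `N` large gives the theorem (`le_of_forall_mul_sub_le`). -/

namespace NumberField

open scoped IntermediateField

open Height

/-! ### Heights under extension of number fields -/

section Extension

variable {K L : Type*} [Field K] [NumberField K] [Field L] [NumberField L] [Algebra K L]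

theorem prod_infinitePlace_eq_prod_embeddings {M : Type*} [CommMonoid M] (g : InfinitePlace K → M) :
    ∏ v : InfinitePlace K, g v ^ v.mult = ∏ φ : K →+* ℂ, g (InfinitePlace.mk φ) := by
  classical
  rw [← Finset.prod_fiberwise Finset.univ InfinitePlace.mk]
  refine Finset.prod_congr rfl fun v _ => ?_
  rw [Finset.prod_congr rfl (g := fun _ => g v)
    (fun φ hφ => by rw [(Finset.mem_filter.mp hφ).2]), Finset.prod_const,
    InfinitePlace.card_filter_mk_eq]

theorem card_embeddings_extending (φ : K →+* ℂ) [DecidablePred fun ψ : L →+* ℂ => ψ.comp (algebraMap K L) = φ] :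
    (Finset.univ.filter fun ψ : L →+* ℂ => ψ.comp (algebraMap K L) = φ).card =
      Module.finrank K L := by
  let := φ.toAlgebra
  have : Module.Finite K L := Module.Finite.of_restrictScalars_finite ℚ K L
  rw [← AlgHom.card K L ℂ, Fintype.card_eq_nat_card, ← Fintype.card_subtype,
    Fintype.card_eq_nat_card]
  exact Nat.card_congr
    { toFun := fun ψ => { ψ.1 with commutes' := fun r => RingHom.congr_fun ψ.2 r }
      invFun := fun ψ => ⟨ψ.toRingHom, RingHom.ext fun r => ψ.commutes r⟩
      left_inv := fun _ => rfl
      right_inv := fun _ => rfl }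

/-- Counting embeddings instead of places absorbs the multiplicities, and each embedding of `K` has
`[L : K]` extensions to `L`. -/
theorem prod_infinitePlace_comap {M : Type*} [CommMonoid M] (g : InfinitePlace K → M) :
    ∏ w : InfinitePlace L, g (w.comap (algebraMap K L)) ^ w.mult =
      (∏ v : InfinitePlace K, g v ^ v.mult) ^ Module.finrank K L := by
  classical
  rw [prod_infinitePlace_eq_prod_embeddings (fun w : InfinitePlace L => g (w.comap (algebraMap K L))),
    prod_infinitePlace_eq_prod_embeddings, ← Finset.prod_pow,
    ← Finset.prod_fiberwise Finset.univ fun ψ : L →+* ℂ => ψ.comp (algebraMap K L)]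
  refine Finset.prod_congr rfl fun φ _ => ?_
  rw [← card_embeddings_extending (L := L) φ, ← Finset.prod_const]
  exact Finset.prod_congr rfl fun ψ hψ => by
    rw [InfinitePlace.comap_mk, (Finset.mem_filter.mp hψ).2]

/-- The finite places contribute the inverse of the norm of the ideal `(a, b)`. Base change of
heights is thereby reduced to ideal norms and complex embeddings. -/
theorem mulHeight₁_div_mul_absNorm {F : Type*} [Field F] [NumberField F] (a b : 𝓞 F) (hb : b ≠ 0) :
    mulHeight₁ ((a : F) / (b : F)) * (Ideal.span (Set.range ![a, b])).absNorm =
      ∏ v : InfinitePlace F, (max (v (a : F)) (v (b : F))) ^ v.mult := by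
  have h1 : (![(a : F), (b : F)] : Fin 2 → F) ≠ 0 := by
    intro h
    exact hb (by simpa using congrFun h 1)
  have h2 : ![a, b] ≠ 0 := fun h => hb (by simpa using congrFun h 1)
  have h3 := absNorm_mul_finprod_finitePlace_eq_one h2
  have h4 : ∀ i, ((![a, b] i : 𝓞 F) : F) = ![(a : F), (b : F)] i := by
    intro i; fin_cases i <;> rfl
  simp only [h4] at h3
  rw [mulHeight₁_div_eq_mulHeight, mulHeight_eq h1, mul_assoc, mul_comm (finprod _), h3, mul_one]
  refine Finset.prod_congr rfl fun v _ => ?_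
  congr 1
  refine eq_of_forall_ge_iff fun c => ?_
  rw [ciSup_le_iff (Set.finite_range _).bddAbove, Fin.forall_fin_two]
  simp

/-- The height of an algebraic number is multiplied by the degree in a field extension. -/
theorem mulHeight₁_algebraMap (x : K) :
    mulHeight₁ (algebraMap K L x) = mulHeight₁ x ^ Module.finrank K L := by
  obtain ⟨a, b, hb, rfl⟩ := IsFractionRing.div_surjective (A := 𝓞 K) x
  have hb0 : b ≠ 0 := nonZeroDivisors.ne_zero hb
  have hinjO : Function.Injective (algebraMap (𝓞 K) (𝓞 L)) :=
    FaithfulSMul.algebraMap_injective (𝓞 K) (𝓞 L)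
  set a' := algebraMap (𝓞 K) (𝓞 L) a
  set b' := algebraMap (𝓞 K) (𝓞 L) b
  have hb0' : b' ≠ 0 := (map_ne_zero_iff _ hinjO).mpr hb0
  have ha' : algebraMap K L (algebraMap (𝓞 K) K a) = algebraMap (𝓞 L) L a' := rfl
  have hb' : algebraMap K L (algebraMap (𝓞 K) K b) = algebraMap (𝓞 L) L b' := rfl
  have hK := mulHeight₁_div_mul_absNorm a b hb0
  have hL := mulHeight₁_div_mul_absNorm a' b' hb0'
  have hspan : Ideal.span (Set.range ![a', b']) =
      (Ideal.span (Set.range ![a, b])).map (algebraMap (𝓞 K) (𝓞 L)) := by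
    rw [Ideal.map_span]
    congr 1
    ext y
    simp [a', b', eq_comm]
  have hrank : Module.finrank (𝓞 K) (𝓞 L) = Module.finrank K L :=
    (IsFractionRing.finrank_eq (𝓞 K) K (𝓞 L) L).symm
  rw [hspan, Ideal.absNorm_algebraMap, hrank] at hL
  have hpos : (Ideal.span (Set.range ![a, b])).absNorm ≠ 0 := by
    rw [Ne, Ideal.absNorm_eq_zero_iff]
    intro h
    exact hb0 (Ideal.span_eq_bot.mp h b ⟨1, rfl⟩)
  have hcomap := prod_infinitePlace_comap (L := L) (fun v : InfinitePlace K =>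
    max (v (algebraMap (𝓞 K) K a)) (v (algebraMap (𝓞 K) K b)))
  simp only [InfinitePlace.comap_apply, ha', hb'] at hcomap
  rw [hcomap, ← hK, mul_pow] at hL
  rw [map_div₀, ha', hb']
  push_cast at hL
  exact mul_right_cancel₀ (pow_ne_zero _ (by exact_mod_cast hpos)) hL

end Extension

/-- The absolute logarithmic height may be computed in any number field. -/
theorem absLogHeight₁_coe {E : Type*} [Field E] [CharZero E] (L : IntermediateField ℚ E) [NumberField L] (y : L) :
    absLogHeight₁ (y : E) = logHeight₁ y / Module.finrank ℚ L := by
  have hy : IsIntegral ℚ (y : E) := (Algebra.IsIntegral.isIntegral (R := ℚ) y).map L.val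
  have : FiniteDimensional ℚ ℚ⟮(y : E)⟯ := IntermediateField.adjoin.finiteDimensional hy
  have : NumberField ℚ⟮(y : E)⟯ := {}
  have hle : ℚ⟮(y : E)⟯ ≤ L := by
    rw [IntermediateField.adjoin_simple_le_iff]; exact y.2
  let : Algebra ℚ⟮(y : E)⟯ L := (IntermediateField.inclusion hle).toRingHom.toAlgebra
  have h1 : algebraMap ℚ⟮(y : E)⟯ L (IntermediateField.AdjoinSimple.gen ℚ (y : E)) = y := by
    apply Subtype.ext; rfl
  have h2 := mulHeight₁_algebraMap (L := L) (IntermediateField.AdjoinSimple.gen ℚ (y : E))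
  rw [h1] at h2
  have h3 : Module.finrank ℚ ℚ⟮(y : E)⟯ * Module.finrank ℚ⟮(y : E)⟯ L = Module.finrank ℚ L :=
    Module.finrank_mul_finrank _ _ _
  have hL : 0 < Module.finrank ℚ L := Module.finrank_pos
  have hx : 0 < Module.finrank ℚ ℚ⟮(y : E)⟯ := Module.finrank_pos
  have hM : 0 < Module.finrank ℚ⟮(y : E)⟯ L := Nat.pos_of_mul_pos_left (h3 ▸ hL) 
  rw [absLogHeight₁, absMulHeight₁, dif_pos hy, Real.log_rpow (mulHeight₁_pos _),
    logHeight₁_eq_log_mulHeight₁, h2, Real.log_pow, ← h3]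
  have hx' : (Module.finrank ℚ ℚ⟮(y : E)⟯ : ℝ) ≠ 0 := by positivity
  have hM' : (Module.finrank ℚ⟮(y : E)⟯ L : ℝ) ≠ 0 := by positivity
  push_cast
  field_simp

end NumberField

/-! ### The normal form in an affine coordinate -/

section QuadraticNormalForm

variable {K : Type*} [Field K]

/-- The quadratic map `w ↦ w (w + μ) / (1 + λ w)`, with the convention that `a / 0 = 0`. Its fixed
points at infinity and at the origin have multipliers `λ` and `μ`. -/
def quadNormalForm (lam mu w : K) : K := w * (mu + w) / (1 + lam * w)

/-- The quadratic equation is the vanishing of the numerator of the derivative; `λ μ ≠ 1` keeps its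
roots away from the pole. -/
theorem quadNormalForm_critical {lam mu w : K} (h1 : lam * mu ≠ 1)
    (hw : lam * w ^ 2 + 2 * w + mu = 0) : quadNormalForm lam mu w = -w ^ 2 := by
  have hne : 1 + lam * w ≠ 0 := by
    intro h
    apply h1
    have hmu : mu = -w := by linear_combination hw - w * h
    rw [hmu]
    linear_combination -h
  rw [quadNormalForm, div_eq_iff hne]
  linear_combination w * hw

end QuadraticNormalForm

/-! ### Escape of a critical orbit towards infinity at one place -/

namespace AbsoluteValue

variable {K : Type*} [Field K] (v : AbsoluteValue K ℝ) {lam mu w u : K}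

/-- The numerator factor `μ + u` has size at least `(1 - |λ|) |u|`, the denominator at most `(1 +
|λ|) |λ u|`, and `(1 - |λ|) / (1 + |λ|) ≥ 1/3`. -/
theorem le_quadNormalForm_of_lt_third (hlam : lam ≠ 0) (hl : v lam < 1 / 3)
    (hu : 1 ≤ v lam ^ 2 * v u) (hmu : v mu ≤ v lam * v u) :
    1 / (3 * v lam) * v u ≤ v (quadNormalForm lam mu u) := by
  have hl0 : 0 < v lam := v.pos hlam
  have hu0 : 0 < v u := by
    by_contra h
    have : v lam ^ 2 * v u ≤ 0 := mul_nonpos_of_nonneg_of_nonpos (sq_nonneg _) (not_lt.mp h)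
    linarith
  have h1 : (1 - v lam) * v u ≤ v (mu + u) := by
    have := v.add_le (mu + u) (-mu)
    rw [v.map_neg, show mu + u + -mu = u by ring] at this
    nlinarith
  have h2 : v (1 + lam * u) ≤ (1 + v lam) * (v lam * v u) := by
    have := v.add_le 1 (lam * u)
    rw [v.map_one, v.map_mul] at this
    nlinarith
  have h3 : 0 < v (1 + lam * u) := by
    have := v.add_le (1 + lam * u) (-1)
    rw [v.map_neg, v.map_one, show 1 + lam * u + -1 = lam * u by ring, v.map_mul] at this
    nlinarith
  rw [quadNormalForm, map_div₀, v.map_mul, le_div_iff₀ h3]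
  calc 1 / (3 * v lam) * v u * v (1 + lam * u)
      ≤ 1 / (3 * v lam) * v u * ((1 + v lam) * (v lam * v u)) := by gcongr
    _ = v u * ((1 + v lam) / 3 * v u) := by field_simp
    _ ≤ v u * ((1 - v lam) * v u) := by
        gcongr
        linarith
    _ ≤ v u * v (mu + u) := by gcongr

/-- By the ultrametric inequality `u` dominates `μ` and `λ u` dominates `1`, so nothing is lost. -/
theorem le_quadNormalForm_of_isNonarchimedean (hv : IsNonarchimedean v) (hlam : lam ≠ 0)
    (hl : v lam < 1) (hu : 1 < v lam * v u) (hmu : v mu ≤ v lam * v u) :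
    1 / v lam * v u ≤ v (quadNormalForm lam mu u) := by
  have hl0 : 0 < v lam := v.pos hlam
  have hu0 : 0 < v u := by
    by_contra h
    have : v lam * v u ≤ 0 := mul_nonpos_of_nonneg_of_nonpos hl0.le (not_lt.mp h)
    linarith
  have h1 : v (mu + u) = v u := hv.add_eq_right_of_lt (by nlinarith)
  have h2 : v (1 + lam * u) = v lam * v u := by
    rw [hv.add_eq_right_of_lt (by rw [v.map_one, v.map_mul]; exact hu), v.map_mul]
  rw [quadNormalForm, map_div₀, v.map_mul, h1, h2]
  apply le_of_eq
  field_simp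

/-- Since `rho ≥ 1`, sizes never decrease, so both conditions for a growth step persist along the
orbit. -/
theorem pow_le_iterate_quadNormalForm {rho T : ℝ} (hrho : 1 ≤ rho)
    (hstep : ∀ u, T ≤ v u → v mu ≤ v lam * v u → rho * v u ≤ v (quadNormalForm lam mu u))
    (hu : T ≤ v u) (hu1 : 1 ≤ v u) (hmu : v mu ≤ v lam * v u) (N : ℕ) :
    rho ^ N ≤ v ((quadNormalForm lam mu)^[N] u) := by
  suffices h : T ≤ v ((quadNormalForm lam mu)^[N] u) ∧
      v mu ≤ v lam * v ((quadNormalForm lam mu)^[N] u) ∧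
      rho ^ N ≤ v ((quadNormalForm lam mu)^[N] u) from h.2.2
  induction N with
  | zero => exact ⟨hu, hmu, by simpa using hu1⟩
  | succ n ih =>
    obtain ⟨h1, h2, h3⟩ := ih
    rw [Function.iterate_succ_apply']
    set z := (quadNormalForm lam mu)^[n] u
    have h4 := hstep z h1 h2
    have h5 : v z ≤ v (quadNormalForm lam mu z) :=
      (le_mul_of_one_le_left (v.nonneg z) hrho).trans h4
    refine ⟨h1.trans h5, h2.trans (mul_le_mul_of_nonneg_left h5 (v.nonneg _)), ?_⟩
    rw [pow_succ']
    exact (mul_le_mul_of_nonneg_left h3 (by linarith)).trans h4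

open Real in
-- The larger critical point escapes; which one it is depends on the place, so both appear on the
-- right. The extra iterate is the passage to the critical value.
theorem mul_posLog_le_of_arch (h2 : v 2 = 2) (hlam : lam ≠ 0) (h1 : lam * mu ≠ 1)
    {w₁ w₂ : K} (hsum : lam * (w₁ + w₂) = -2) (hprod : lam * (w₁ * w₂) = mu) (N : ℕ) :
    N * (log⁺ (v lam⁻¹) - log 3) ≤
      log⁺ (v ((quadNormalForm lam mu)^[N + 1] w₁)) +
        log⁺ (v ((quadNormalForm lam mu)^[N + 1] w₂)) := by
  wlog hle : v w₂ ≤ v w₁ generalizing w₁ w₂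
  · rw [add_comm (log⁺ _)]
    exact this (by rw [← hsum]; ring) (by rw [← hprod]; ring) (not_le.mp hle).le
  have hl0 : 0 < v lam := v.pos hlam
  refine le_trans ?_ (le_add_of_nonneg_right posLog_nonneg)
  rcases lt_or_ge (v lam) (1 / 3) with hl | hl
  · have hcrit : lam * w₁ ^ 2 + 2 * w₁ + mu = 0 := by linear_combination w₁ * hsum - hprod
    rw [Function.iterate_succ_apply, quadNormalForm_critical h1 hcrit]
    have hw : 1 ≤ v lam * v w₁ := by
      have := congrArg v hsum
      rw [v.map_mul, v.map_neg, h2] at this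
      have := v.add_le w₁ w₂
      nlinarith
    have hvu : v (-w₁ ^ 2) = v w₁ ^ 2 := by rw [v.map_neg, map_pow]
    have hu : 1 ≤ v lam ^ 2 * v (-w₁ ^ 2) := by
      rw [hvu, ← mul_pow]
      exact one_le_pow₀ hw
    have hu1 : 1 ≤ v (-w₁ ^ 2) := by
      have : v lam ^ 2 ≤ 1 := by nlinarith
      have h0 := v.nonneg (-w₁ ^ 2)
      nlinarith
    -- From `μ = λ w₁ w₂` and `|w₂| ≤ |w₁|`: no separate control of `μ` is needed.
    have hmu : v mu ≤ v lam * v (-w₁ ^ 2) := by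
      rw [← hprod, v.map_mul, v.map_mul, hvu, sq]
      have := v.nonneg w₁
      gcongr
    have hrho : 1 ≤ 1 / (3 * v lam) := by
      rw [le_div_iff₀ (by positivity)]
      linarith
    have key := v.pow_le_iterate_quadNormalForm (T := 1 / v lam ^ 2) hrho
      (fun u hu hmu => v.le_quadNormalForm_of_lt_third hlam hl
        (by rwa [div_le_iff₀' (by positivity)] at hu) hmu)
      (by rwa [div_le_iff₀' (by positivity)]) hu1 hmu N
    refine le_trans ?_ (posLog_le_posLog (by positivity) key)
    have hinv : 1 ≤ (v lam)⁻¹ := (one_le_inv₀ hl0).mpr (by linarith)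
    rw [posLog_pow, map_inv₀, posLog_eq_log (x := (v lam)⁻¹) (by rwa [abs_of_pos (by positivity)]),
      posLog_eq_log (x := 1 / (3 * v lam)) (by rwa [abs_of_pos (by positivity)]),
      Real.log_div one_ne_zero (by positivity), Real.log_mul (by norm_num) hl0.ne', Real.log_inv,
      Real.log_one]
    apply le_of_eq
    ring
  -- When `|λ| ≥ 1/3` the left side is not positive.
  · refine le_trans (mul_nonpos_of_nonneg_of_nonpos N.cast_nonneg ?_) posLog_nonneg
    rw [sub_nonpos, ← posLog_eq_log (x := 3) (by norm_num), map_inv₀]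
    refine posLog_le_posLog (by positivity) ?_
    rw [inv_le_comm₀ hl0 (by norm_num)]
    linarith

open Real in
theorem mul_posLog_le_of_isNonarchimedean (hv : IsNonarchimedean v) (h20 : (2 : K) ≠ 0)
    (hlam : lam ≠ 0) (h1 : lam * mu ≠ 1)
    {w₁ w₂ : K} (hsum : lam * (w₁ + w₂) = -2) (hprod : lam * (w₁ * w₂) = mu) (N : ℕ) :
    N * (log⁺ (v lam⁻¹) - log⁺ (v 4⁻¹)) ≤
      log⁺ (v ((quadNormalForm lam mu)^[N + 1] w₁)) +
        log⁺ (v ((quadNormalForm lam mu)^[N + 1] w₂)) := by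
  wlog hle : v w₂ ≤ v w₁ generalizing w₁ w₂
  · rw [add_comm (log⁺ _)]
    exact this (by rw [← hsum]; ring) (by rw [← hprod]; ring) (not_le.mp hle).le
  have hl0 : 0 < v lam := v.pos hlam
  have h4 : v 4 = v 2 ^ 2 := by rw [← map_pow]; norm_num
  have h40 : 0 < v 2 := v.pos h20
  have h2le : v 2 ≤ 1 := by simpa using hv.apply_natCast_le_one (n := 2)
  have h4le : v 4 ≤ 1 := by rw [h4]; exact pow_le_one₀ h40.le h2le
  have h4pos : 0 < v 4 := by rw [h4]; positivity
  refine le_trans ?_ (le_add_of_nonneg_right posLog_nonneg)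
  rcases lt_or_ge (v lam) (v 4) with hl | hl
  · have hcrit : lam * w₁ ^ 2 + 2 * w₁ + mu = 0 := by linear_combination w₁ * hsum - hprod
    rw [Function.iterate_succ_apply, quadNormalForm_critical h1 hcrit]
    have hw : v 2 ≤ v lam * v w₁ := by
      have := congrArg v hsum
      rw [v.map_mul, v.map_neg] at this
      rw [← this]
      gcongr
      exact (hv w₁ w₂).trans_eq (max_eq_left hle)
    have hl1 : v lam < 1 := hl.trans_le h4le
    have hvu : v (-w₁ ^ 2) = v w₁ ^ 2 := by rw [v.map_neg, map_pow]
    -- The threshold `|4|` arises here: `|λ w₁²| = |λ w₁|² / |λ| ≥ |4| / |λ| > 1`.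
    have hu : 1 < v lam * v (-w₁ ^ 2) := by
      have h5 : v 4 ≤ (v lam * v w₁) ^ 2 := by
        rw [h4]
        gcongr
      rw [hvu]
      by_contra! hcon
      have : (v lam * v w₁) ^ 2 ≤ v lam := by
        rw [mul_pow, sq (v lam), mul_assoc]
        exact mul_le_of_le_one_right hl0.le hcon
      linarith
    have hu1 : 1 ≤ v (-w₁ ^ 2) := by
      have h0 := v.nonneg (-w₁ ^ 2)
      nlinarith
    have hmu : v mu ≤ v lam * v (-w₁ ^ 2) := by
      rw [← hprod, v.map_mul, v.map_mul, hvu, sq]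
      have := v.nonneg w₁
      gcongr
    have hrho : 1 ≤ 1 / v lam := by
      rw [le_div_iff₀ (by positivity)]
      linarith
    have key := v.pow_le_iterate_quadNormalForm (T := v (-w₁ ^ 2)) hrho
      (fun u hu' hmu => v.le_quadNormalForm_of_isNonarchimedean hv hlam hl1
        (hu.trans_le (mul_le_mul_of_nonneg_left hu' hl0.le)) hmu) le_rfl hu1 hmu N
    refine le_trans ?_ (posLog_le_posLog (by positivity) key)
    rw [posLog_pow, one_div, map_inv₀ v lam]
    have : 0 ≤ log⁺ (v 4⁻¹) := posLog_nonneg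
    gcongr
    linarith
  · refine le_trans (mul_nonpos_of_nonneg_of_nonpos N.cast_nonneg ?_) posLog_nonneg
    rw [sub_nonpos, map_inv₀, map_inv₀]
    refine posLog_le_posLog (by positivity) ?_
    gcongr

end AbsoluteValue

/-! ### Summation of the local estimates over all places -/

namespace NumberField

open Height Real

variable {K : Type*} [Field K] [NumberField K]

theorem hasFiniteSupport_posLog (x : K) :
    (fun v : FinitePlace K => log⁺ (v x)).HasFiniteSupport := by
  rcases eq_or_ne x 0 with rfl | hx
  · simp [Function.HasFiniteSupport]
  refine (FinitePlace.hasFiniteMulSupport hx).subset fun v hv => ?_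
  rw [Function.mem_mulSupport]
  intro h
  simp [h] at hv

theorem logHeight₁_four_le : logHeight₁ (4 : K) ≤ Module.finrank ℚ K * log 4 := by
  have h := logHeight₁_sum_le (Finset.univ : Finset (Fin 4)) (fun _ => (1 : K))
  simpa [totalWeight_eq_finrank] using h

/-- The critical orbits of a quadratic map come close to a fixed point of small multiplier. -/
theorem mul_logHeight₁_le {lam mu w₁ w₂ : K} (hlam : lam ≠ 0) (h1 : lam * mu ≠ 1)
    (hsum : lam * (w₁ + w₂) = -2) (hprod : lam * (w₁ * w₂) = mu) (N : ℕ) :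
    N * (logHeight₁ lam - Module.finrank ℚ K * log 12) ≤
      logHeight₁ ((quadNormalForm lam mu)^[N + 1] w₁) +
        logHeight₁ ((quadNormalForm lam mu)^[N + 1] w₂) := by
  set u₁ := (quadNormalForm lam mu)^[N + 1] w₁
  set u₂ := (quadNormalForm lam mu)^[N + 1] w₂
  have harch : N * ((∑ v : InfinitePlace K, v.mult * log⁺ (v lam⁻¹)) -
        Module.finrank ℚ K * log 3) ≤
      (∑ v : InfinitePlace K, v.mult * log⁺ (v u₁)) +
        ∑ v : InfinitePlace K, v.mult * log⁺ (v u₂) := by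
    rw [← InfinitePlace.sum_mult_eq, Nat.cast_sum, Finset.sum_mul, ← Finset.sum_sub_distrib,
      Finset.mul_sum, ← Finset.sum_add_distrib]
    refine Finset.sum_le_sum fun v _ => ?_
    have h2 : v.1 2 = 2 := by
      have : v 2 = 2 := by
        rw [← InfinitePlace.norm_embedding_eq, map_ofNat]
        simp
      exact this
    have := v.1.mul_posLog_le_of_arch h2 hlam h1 hsum hprod N
    calc (N : ℝ) * (v.mult * log⁺ (v lam⁻¹) - v.mult * log 3)
        = v.mult * (N * (log⁺ (v.1 lam⁻¹) - log 3)) := by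
          rw [InfinitePlace.coe_apply]; ring
      _ ≤ v.mult * (log⁺ (v.1 u₁) + log⁺ (v.1 u₂)) := by gcongr
      _ = _ := by rw [InfinitePlace.coe_apply, InfinitePlace.coe_apply]; ring
  have hfin : N * ((∑ᶠ v : FinitePlace K, log⁺ (v lam⁻¹)) - ∑ᶠ v : FinitePlace K, log⁺ (v 4⁻¹)) ≤
      (∑ᶠ v : FinitePlace K, log⁺ (v u₁)) + ∑ᶠ v : FinitePlace K, log⁺ (v u₂) := by
    have hs := hasFiniteSupport_posLog (K := K)
    rw [← finsum_sub_distrib (hs _) (hs _), mul_finsum, ← finsum_add_distrib (hs _) (hs _)]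
    refine finsum_le_finsum' ?_ ?_ fun v => ?_
    · refine ((hs lam⁻¹).union (hs 4⁻¹)).subset fun v hv => ?_
      by_contra hcon
      simp only [Set.mem_union, Function.mem_support, not_or, not_not] at hcon
      exact hv (by simp only [hcon.1, hcon.2, sub_zero, mul_zero])
    · refine ((hs u₁).union (hs u₂)).subset fun v hv => ?_
      by_contra hcon
      simp only [Set.mem_union, Function.mem_support, not_or, not_not] at hcon
      exact hv (by simp only [hcon.1, hcon.2, add_zero])
    · exact v.1.mul_posLog_le_of_isNonarchimedean (FinitePlace.add_le v) two_ne_zero hlam h1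
        hsum hprod N
  -- The total finite loss is at most `h(1/4) = h(4)`.
  have h4 : ∑ᶠ v : FinitePlace K, log⁺ (v 4⁻¹) ≤ Module.finrank ℚ K * log 4 := by
    refine le_trans ?_ logHeight₁_four_le
    rw [← logHeight₁_inv, NumberField.logHeight₁_eq]
    refine le_add_of_nonneg_left (Finset.sum_nonneg fun v _ => ?_)
    exact mul_nonneg (Nat.cast_nonneg _) posLog_nonneg
  -- The height of `λ` is read as that of `1 / λ`, which is supported on the places where `λ` is
  -- small.
  rw [← logHeight₁_inv lam, NumberField.logHeight₁_eq lam⁻¹, NumberField.logHeight₁_eq u₁,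
    NumberField.logHeight₁_eq u₂]
  have h12 : log 12 = log 3 + log 4 := by
    rw [← Real.log_mul (by norm_num) (by norm_num)]; norm_num
  have hN : (0 : ℝ) ≤ N := N.cast_nonneg
  have := mul_le_mul_of_nonneg_left h4 hN
  rw [h12]
  linarith

end NumberField

/-! ### Explicit functoriality of heights in a number field -/

namespace NumberField

open Height

section Relative

variable {K : Type*} [Field K] [NumberField K]

/-- The `xᵢ` are among the Segre coordinates of the product of the points `[xᵢ : 1]`, whose height
is the sum. -/
theorem logHeight_le_sum_logHeight₁ {ι : Type*} [Fintype ι] (x : ι → K) :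
    logHeight x ≤ ∑ i, logHeight₁ (x i) := by
  classical
  have h := logHeight_fun_prod_eq (x := fun i : ι => ![x i, 1])
    (fun i hi => one_ne_zero (congrFun hi 1))
  simp only [← logHeight₁_eq_logHeight] at h
  rw [← h]
  let e : ι → ((i : ι) → Fin 2) := fun i j => if j = i then 0 else 1
  have hx : x = (fun I : (i : ι) → Fin 2 => ∏ a, (![x a, 1] : Fin 2 → K) (I a)) ∘ e := by
    funext i
    rw [Function.comp_apply, Finset.prod_eq_single i]
    · simp [e]
    · intro j _ hj
      simp [e, hj]
    · simp
  conv_lhs => rw [hx]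
  exact logHeight_comp_le e _

theorem logHeight_linearMap_le {ι ι' : Type*} [Fintype ι] [Fintype ι'] (A : ι' × ι → K) (x : ι → K) :
    logHeight (fun j => ∑ i, A (j, i) * x i) ≤
      Module.finrank ℚ K * Real.log (Nat.card ι) + ∑ a, logHeight₁ (A a) + logHeight x := by
  have h1 := logHeight_linearMap_apply_le A x
  have h2 := logHeight_le_sum_logHeight₁ A
  rw [totalWeight_eq_finrank] at h1
  linarith

theorem logHeight₁_moebius_le (a b c d x y : K) :
    logHeight₁ ((a * x + b * y) / (c * x + d * y)) ≤ Module.finrank ℚ K * Real.log 2 +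
      (logHeight₁ a + logHeight₁ b + logHeight₁ c + logHeight₁ d) + logHeight₁ (x / y) := by
  have h := logHeight_linearMap_le (fun p : Fin 2 × Fin 2 => !![a, b; c, d] p.1 p.2) ![x, y]
  rw [Fintype.sum_prod_type] at h
  simp only [Fin.sum_univ_two, Nat.card_eq_fintype_card, Fintype.card_fin] at h
  rw [logHeight₁_div_eq_logHeight, logHeight₁_div_eq_logHeight]
  have e : (fun j : Fin 2 => !![a, b; c, d] j 0 * ![x, y] 0 + !![a, b; c, d] j 1 * ![x, y] 1) =
      ![a * x + b * y, c * x + d * y] := by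
    funext j; fin_cases j <;> simp
  rw [e] at h
  simp at h
  linarith

theorem logHeight₁_quadratic_le (lam mu : K) {x y : K} (hxy : ![x, y] ≠ 0) :
    logHeight₁ (x * (x + lam * y) / (y * (mu * x + y))) ≤ 2 * logHeight₁ (x / y) +
      (5 * (logHeight₁ lam + logHeight₁ mu) + Module.finrank ℚ K * (4 * Real.log 2)) := by
  let A : Fin 2 × (Fin 2 × Fin 2) → K := fun p =>
    (![![![1, lam], ![0, 0]], ![![0, mu], ![0, 1]]] : Fin 2 → Fin 2 → Fin 2 → K) p.1 p.2.1 p.2.2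
  have h := logHeight_linearMap_le A (fun p => ![x, y] p.1 * ![x, y] p.2)
  have e : (fun j => ∑ i, A (j, i) * (![x, y] i.1 * ![x, y] i.2)) =
      ![x * (x + lam * y), y * (mu * x + y)] := by
    funext j
    fin_cases j <;> simp [A, Fintype.sum_prod_type] <;> ring
  have eA : ∑ a, logHeight₁ (A a) = logHeight₁ lam + logHeight₁ mu := by
    simp [A, Fintype.sum_prod_type]
  rw [e, eA, logHeight_fun_mul_eq hxy hxy, ← logHeight₁_div_eq_logHeight,
    ← logHeight₁_div_eq_logHeight, Nat.card_eq_fintype_card, Fintype.card_prod,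
    Fintype.card_fin] at h
  have hlog : Real.log 4 = 2 * Real.log 2 := by
    rw [show (4 : ℝ) = 2 ^ 2 by norm_num, Real.log_pow]; norm_num
  norm_num [hlog] at h
  have h1 := zero_le_logHeight₁ lam
  have h2 := zero_le_logHeight₁ mu
  have h3 : (0 : ℝ) ≤ Module.finrank ℚ K * Real.log 2 := by positivity
  linarith

/-- Elimination: `(1 - λ μ) x³` and `(1 - λ μ) y³` are combinations of the two forms with linear
coefficients. Hence `3 h(x/y)` is at most `h(x/y)` plus the height of the image plus a constant. The
entries of the elimination matrix produce the factor 5 and the `4 log 2`. -/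
theorem le_logHeight₁_quadratic {lam mu : K} (hD : lam * mu ≠ 1) {x y : K} (hxy : ![x, y] ≠ 0) :
    2 * logHeight₁ (x / y) ≤ logHeight₁ (x * (x + lam * y) / (y * (mu * x + y))) +
      (5 * (logHeight₁ lam + logHeight₁ mu) + Module.finrank ℚ K * (4 * Real.log 2)) := by
  have hD0 : 1 - lam * mu ≠ 0 := sub_ne_zero.mpr hD.symm
  have hF : ![x * (x + lam * y), y * (mu * x + y)] ≠ 0 := by
    intro hF
    have h0 : x * (x + lam * y) = 0 := congrFun hF 0
    have h1 : y * (mu * x + y) = 0 := congrFun hF 1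
    have hx : (1 - lam * mu) * x ^ 3 = 0 := by
      linear_combination ((1 - lam * mu) * x - lam * y) * h0 + lam ^ 2 * x * h1
    have hy : (1 - lam * mu) * y ^ 3 = 0 := by
      linear_combination ((1 - lam * mu) * y - mu * x) * h1 + mu ^ 2 * y * h0
    simp only [mul_eq_zero, hD0, false_or, ne_eq, OfNat.ofNat_ne_zero, not_false_eq_true,
      pow_eq_zero_iff] at hx hy
    exact hxy (by simp [hx, hy])
  let A : Fin 2 × (Fin 2 × Fin 2) → K := fun p =>
    (![![![1 - lam * mu, lam ^ 2], ![-lam, 0]], ![![0, -mu], ![mu ^ 2, 1 - lam * mu]]] :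
      Fin 2 → Fin 2 → Fin 2 → K) p.1 p.2.1 p.2.2
  have h := logHeight_linearMap_le A
    (fun p => ![x, y] p.1 * ![x * (x + lam * y), y * (mu * x + y)] p.2)
  have e : (fun j => ∑ i, A (j, i) * (![x, y] i.1 * ![x * (x + lam * y), y * (mu * x + y)] i.2)) =
      (1 - lam * mu) • ![x, y] ^ 3 := by
    funext j
    fin_cases j <;> simp [A, Fintype.sum_prod_type] <;> ring
  have eA : ∑ a, logHeight₁ (A a) =
      2 * logHeight₁ (1 - lam * mu) + 3 * logHeight₁ lam + 3 * logHeight₁ mu := by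
    simp [A, Fintype.sum_prod_type, logHeight₁_pow]
    ring
  rw [e, eA, logHeight_fun_mul_eq hxy hF, ← logHeight₁_div_eq_logHeight,
    ← logHeight₁_div_eq_logHeight, logHeight_smul_eq_logHeight _ hD0, logHeight_pow,
    ← logHeight₁_div_eq_logHeight, Nat.card_eq_fintype_card, Fintype.card_prod,
    Fintype.card_fin] at h
  have hlog : Real.log 4 = 2 * Real.log 2 := by
    rw [show (4 : ℝ) = 2 ^ 2 by norm_num, Real.log_pow]; norm_num
  norm_num [hlog] at h
  have h1 := logHeight₁_sub_le 1 (lam * mu)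
  have h2 := logHeight₁_mul_le lam mu
  rw [totalWeight_eq_finrank, logHeight₁_one] at h1
  linarith

end Relative

/-! ### Passage to absolute heights -/

section Absolute

theorem exists_numberField_subset {S : Set Qbar} (hS : S.Finite) :
    ∃ L : IntermediateField ℚ Qbar, NumberField L ∧ S ⊆ L := by
  have : Finite S := hS
  have : FiniteDimensional ℚ (IntermediateField.adjoin ℚ S) :=
    IntermediateField.finiteDimensional_adjoin fun x _ =>
      ((AlgebraicClosure.isAlgebraic ℚ).isAlgebraic x).isIntegral
  exact ⟨IntermediateField.adjoin ℚ S, {}, IntermediateField.subset_adjoin ℚ S⟩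

theorem absLogHeight₁_nonneg (x : Qbar) : 0 ≤ absLogHeight₁ x := by
  obtain ⟨L, _, hL⟩ := exists_numberField_subset (Set.finite_singleton x)
  rw [absLogHeight₁_coe L ⟨x, hL rfl⟩]
  exact div_nonneg (zero_le_logHeight₁ _) (Nat.cast_nonneg _)

theorem absLogHeight₁_inv (x : Qbar) : absLogHeight₁ x⁻¹ = absLogHeight₁ x := by
  obtain ⟨L, _, hL⟩ := exists_numberField_subset (Set.finite_singleton x)
  have h1 := absLogHeight₁_coe L ⟨x, hL rfl⟩
  have h2 := absLogHeight₁_coe L (⟨x, hL rfl⟩ : L)⁻¹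
  rw [logHeight₁_inv, ← h1] at h2
  exact h2

theorem absLogHeight₁_zero : absLogHeight₁ (0 : Qbar) = 0 := by
  obtain ⟨L, _, _⟩ := exists_numberField_subset (Set.finite_singleton 0)
  have h := absLogHeight₁_coe L 0
  simpa using h

theorem absLogHeight₁_one : absLogHeight₁ (1 : Qbar) = 0 := by
  obtain ⟨L, _, _⟩ := exists_numberField_subset (Set.finite_singleton 0)
  have h := absLogHeight₁_coe L 1
  simpa using h

theorem absLogHeight₁_moebius_le (a b c d x y : Qbar) :
    absLogHeight₁ ((a * x + b * y) / (c * x + d * y)) ≤ Real.log 2 +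
      (absLogHeight₁ a + absLogHeight₁ b + absLogHeight₁ c + absLogHeight₁ d) +
      absLogHeight₁ (x / y) := by
  obtain ⟨L, _, hL⟩ := exists_numberField_subset (Set.toFinite {a, b, c, d, x, y})
  simp only [Set.insert_subset_iff, Set.singleton_subset_iff, SetLike.mem_coe] at hL
  obtain ⟨ha, hb, hc, hd, hx, hy⟩ := hL
  lift a to L using ha
  lift b to L using hb
  lift c to L using hc
  lift d to L using hd
  lift x to L using hx
  lift y to L using hy
  have h := logHeight₁_moebius_le a b c d x y
  have hn : (0 : ℝ) < Module.finrank ℚ L := Nat.cast_pos.mpr Module.finrank_pos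
  norm_cast
  simp only [absLogHeight₁_coe]
  rw [div_le_iff₀ hn]
  refine h.trans_eq ?_
  field_simp

theorem abs_absLogHeight₁_quadratic_sub_le {lam mu : Qbar} (hD : lam * mu ≠ 1) {x y : Qbar}
    (hxy : ![x, y] ≠ 0) :
    |absLogHeight₁ (x * (x + lam * y) / (y * (mu * x + y))) - 2 * absLogHeight₁ (x / y)| ≤
      5 * (absLogHeight₁ lam + absLogHeight₁ mu) + 4 * Real.log 2 := by
  obtain ⟨L, _, hL⟩ := exists_numberField_subset (Set.toFinite {lam, mu, x, y})
  simp only [Set.insert_subset_iff, Set.singleton_subset_iff, SetLike.mem_coe] at hL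
  obtain ⟨ha, hb, hx, hy⟩ := hL
  lift lam to L using ha
  lift mu to L using hb
  lift x to L using hx
  lift y to L using hy
  have hD' : lam * mu ≠ 1 := by exact_mod_cast hD
  have hxy' : ![x, y] ≠ 0 := by
    intro h
    apply hxy
    have h0 : x = 0 := congrFun h 0
    have h1 : y = 0 := congrFun h 1
    simp [h0, h1]
  have h1 := logHeight₁_quadratic_le lam mu hxy'
  have h2 := le_logHeight₁_quadratic hD' hxy'
  have hn : (0 : ℝ) < Module.finrank ℚ L := Nat.cast_pos.mpr Module.finrank_pos
  norm_cast
  simp only [absLogHeight₁_coe]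
  have e : ∀ A B C D : ℝ, ∀ n : ℝ, 0 < n → A ≤ 2 * B + (5 * (C + D) + n * (4 * Real.log 2)) →
      2 * B ≤ A + (5 * (C + D) + n * (4 * Real.log 2)) →
      |A / n - 2 * (B / n)| ≤ 5 * (C / n + D / n) + 4 * Real.log 2 := by
    intro A B C D n hn h1 h2
    have e1 : A / n - 2 * (B / n) = (A - 2 * B) / n := by ring
    have e2 : 5 * (C / n + D / n) + 4 * Real.log 2 = (5 * (C + D) + n * (4 * Real.log 2)) / n := by
      field_simp
    rw [e1, e2, abs_div, abs_of_pos hn]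
    gcongr
    rw [abs_le]
    constructor <;> linarith
  exact e _ _ _ _ _ hn h1 h2

theorem mul_absLogHeight₁_le {lam mu w₁ w₂ : Qbar} (hlam : lam ≠ 0) (h1 : lam * mu ≠ 1)
    (hsum : lam * (w₁ + w₂) = -2) (hprod : lam * (w₁ * w₂) = mu) (N : ℕ) :
    N * (absLogHeight₁ lam - Real.log 12) ≤
      absLogHeight₁ ((quadNormalForm lam mu)^[N + 1] w₁) +
        absLogHeight₁ ((quadNormalForm lam mu)^[N + 1] w₂) := by
  obtain ⟨L, _, hL⟩ := exists_numberField_subset (Set.toFinite {lam, mu, w₁, w₂})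
  simp only [Set.insert_subset_iff, Set.singleton_subset_iff, SetLike.mem_coe] at hL
  obtain ⟨ha, hb, hx, hy⟩ := hL
  lift lam to L using ha
  lift mu to L using hb
  lift w₁ to L using hx
  lift w₂ to L using hy
  have h := mul_logHeight₁_le (lam := lam) (mu := mu) (w₁ := w₁) (w₂ := w₂)
    (by exact_mod_cast hlam) (by exact_mod_cast h1)
    (Subtype.ext hsum) (by exact_mod_cast hprod) N
  have hn : (0 : ℝ) < Module.finrank ℚ L := Nat.cast_pos.mpr Module.finrank_pos
  have hsemi : Function.Semiconj ((↑) : L → Qbar) (quadNormalForm lam mu)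
      (quadNormalForm (lam : Qbar) (mu : Qbar)) := fun w => by
    simp [quadNormalForm]
  have hit (w : L) : (quadNormalForm (lam : Qbar) (mu : Qbar))^[N + 1] (w : Qbar) =
      ((quadNormalForm lam mu)^[N + 1] w : L) := ((hsemi.iterate_right (N + 1)) w).symm
  rw [hit, hit, absLogHeight₁_coe, absLogHeight₁_coe, absLogHeight₁_coe, ← add_div,
    le_div_iff₀ hn]
  refine le_trans (le_of_eq ?_) h
  field_simp

end Absolute

end NumberField

/-! ### Binary quadratic forms and ramification of quadratic maps -/

open MvPolynomial in
/-- A binary quadratic form is a combination of the three monomials of degree two. -/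
theorem MvPolynomial.IsHomogeneous.exists_eq_quadratic {R : Type*} [CommRing R]
    {p : MvPolynomial (Fin 2) R} (hp : p.IsHomogeneous 2) :
    ∃ a b c : R, p = C a * X 0 ^ 2 + C b * (X 0 * X 1) + C c * X 1 ^ 2 := by
  refine ⟨p.coeff (Finsupp.single 0 2), p.coeff (Finsupp.single 0 1 + Finsupp.single 1 1),
    p.coeff (Finsupp.single 1 2), ?_⟩
  have h0 : (X 0 ^ 2 : MvPolynomial (Fin 2) R) = monomial (Finsupp.single 0 2) 1 := X_pow_eq_monomial
  have h1 : (X 0 * X 1 : MvPolynomial (Fin 2) R) =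
      monomial (Finsupp.single 0 1 + Finsupp.single 1 1) 1 := by
    rw [X, X, monomial_mul, one_mul]
  have h2 : (X 1 ^ 2 : MvPolynomial (Fin 2) R) = monomial (Finsupp.single 1 2) 1 := X_pow_eq_monomial
  have hm : ∀ m n : Fin 2 →₀ ℕ, m = n ↔ m 0 = n 0 ∧ m 1 = n 1 := fun m n => by
    rw [Finsupp.ext_iff, Fin.forall_fin_two]
  ext m
  rw [h0, h1, h2]
  simp only [coeff_add, coeff_C_mul, coeff_monomial]
  by_cases hdeg : m 0 + m 1 = 2
  · have : m = Finsupp.single 0 2 ∨ m = Finsupp.single 0 1 + Finsupp.single 1 1 ∨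
        m = Finsupp.single 1 2 := by
      simp only [hm]
      simp
      omega
    rcases this with rfl | rfl | rfl <;> simp [hm]
  · have hz : p.coeff m = 0 := by
      refine hp.coeff_eq_zero ?_
      rwa [Finsupp.degree_eq_sum, Fin.sum_univ_two]
    rw [hz]
    have n0 : Finsupp.single 0 2 ≠ m := by rintro rfl; simp at hdeg
    have n1 : Finsupp.single 0 1 + Finsupp.single 1 1 ≠ m := by rintro rfl; simp at hdeg
    have n2 : Finsupp.single 1 2 ≠ m := by rintro rfl; simp at hdeg
    simp [n0, n1, n2]

namespace Projectivization

variable {K : Type*} [Field K]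

theorem mk_eq_mk_iff_fin_two {x y : Fin 2 → K} (hx : x ≠ 0) (hy : y ≠ 0) :
    mk K x hx = mk K y hy ↔ x 0 * y 1 = x 1 * y 0 := by
  rw [mk_eq_mk_iff']
  constructor
  · rintro ⟨a, rfl⟩
    simp
    ring
  · intro h
    by_cases h1 : y 1 = 0
    · have h0 : y 0 ≠ 0 := fun h0 => hy (by funext i; fin_cases i <;> simp [h0, h1])
      refine ⟨x 0 / y 0, ?_⟩
      have hx1 : x 1 = 0 := by
        rw [h1, mul_zero] at h
        exact (mul_eq_zero.mp h.symm).resolve_right h0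
      funext i
      fin_cases i <;> simp [h0, h1, hx1]
    · refine ⟨x 1 / y 1, ?_⟩
      funext i
      fin_cases i
      · simp
        field_simp
        linear_combination -h
      · simp [h1]

end Projectivization

namespace RatMap

open Projectivization

section Ramification

variable {K : Type*} [Field K]

theorem map_mk {d : ℕ} (f : RatMap K d) {x : Fin 2 → K} (hx : x ≠ 0) :
    f.map (Projectivization.mk K x hx) = Projectivization.mk K (f.lift x) (f.lift_ne_zero hx) := rfl

theorem eval_linForm (x y : Fin 2 → K) :
    MvPolynomial.eval y (linForm x) = x 1 * y 0 - x 0 * y 1 := by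
  simp [linForm]

theorem linForm_smul (c : K) (x : Fin 2 → K) :
    linForm (c • x) = MvPolynomial.C c * linForm x := by
  simp [linForm]
  ring

theorem linForm_ne_zero {x : Fin 2 → K} (hx : x ≠ 0) : linForm x ≠ 0 := by
  intro h
  have h0 := eval_linForm x ![1, 0]
  have h1 := eval_linForm x ![0, 1]
  rw [h] at h0 h1
  simp at h0 h1
  exact hx (by funext i; fin_cases i <;> simp [h0.symm, h1.symm])

/-- The fibre of a quadratic map through a point is cut out by two linear forms, one of which
vanishes at the point. -/
theorem exists_linForm_mul_linForm [IsAlgClosed K] (f : RatMap K 2) {x : Fin 2 → K} (hx : x ≠ 0) :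
    ∃ z : Fin 2 → K, z ≠ 0 ∧
      MvPolynomial.C (f.lift x 1) * f.form 0 - MvPolynomial.C (f.lift x 0) * f.form 1 =
        linForm x * linForm z := by
  set y := f.lift x with hy
  have hy0 : y ≠ 0 := f.lift_ne_zero hx
  obtain ⟨a₀, b₀, c₀, h₀⟩ := (f.homogeneous 0).exists_eq_quadratic
  obtain ⟨a₁, b₁, c₁, h₁⟩ := (f.homogeneous 1).exists_eq_quadratic
  set a := y 1 * a₀ - y 0 * a₁
  set b := y 1 * b₀ - y 0 * b₁
  set c := y 1 * c₀ - y 0 * c₁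
  have hQ : MvPolynomial.C (y 1) * f.form 0 - MvPolynomial.C (y 0) * f.form 1 =
      MvPolynomial.C a * MvPolynomial.X 0 ^ 2 +
        MvPolynomial.C b * (MvPolynomial.X 0 * MvPolynomial.X 1) +
        MvPolynomial.C c * MvPolynomial.X 1 ^ 2 := by
    rw [h₀, h₁]
    simp only [a, b, c, map_sub, map_mul]
    ring
  have hQx : a * x 0 ^ 2 + b * (x 0 * x 1) + c * x 1 ^ 2 = 0 := by
    have := congrArg (MvPolynomial.eval x) hQ
    simp only [map_sub, map_mul, map_add, map_pow, MvPolynomial.eval_C, MvPolynomial.eval_X] at this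
    rw [← this, hy]
    simp only [lift]
    ring
  obtain ⟨z, hz⟩ : ∃ z : Fin 2 → K,
      MvPolynomial.C (y 1) * f.form 0 - MvPolynomial.C (y 0) * f.form 1 =
        linForm x * linForm z := by
    -- A form vanishing at `x` is divisible by the linear form of `x`; the cofactor is `p X₀ + q
    -- X₁`.
    suffices h : ∃ p q : K, a = x 1 * p ∧ b = x 1 * q - x 0 * p ∧ c = -(x 0 * q) by
      obtain ⟨p, q, ha, hb, hc⟩ := h
      refine ⟨![-q, p], ?_⟩
      rw [hQ, ha, hb, hc]
      simp [linForm]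
      ring
    by_cases hx1 : x 1 = 0
    · have hx0 : x 0 ≠ 0 := fun h0 => hx (by funext i; fin_cases i <;> simp [h0, hx1])
      have ha : a = 0 := by
        simpa [hx1, hx0] using hQx
      refine ⟨-b / x 0, -c / x 0, by simp [ha, hx1], ?_, ?_⟩
      · rw [hx1]; field_simp; ring
      · field_simp
    · refine ⟨a / x 1, (b + x 0 * (a / x 1)) / x 1, ?_, ?_, ?_⟩
      · field_simp
      · field_simp; ring
      · field_simp
        linear_combination hQx
  refine ⟨z, ?_, hz⟩
  -- If `z = 0`, the two forms are proportional, and a zero of one of them becomes a common zero.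
  rintro rfl
  have hzero : MvPolynomial.C (y 1) * f.form 0 - MvPolynomial.C (y 0) * f.form 1 = 0 := by
    rw [hz]
    simp [linForm]
  have heval : ∀ t, y 1 * MvPolynomial.eval t (f.form 0) = y 0 * MvPolynomial.eval t (f.form 1) := by
    intro t
    have := congrArg (MvPolynomial.eval t) hzero
    simpa [sub_eq_zero] using this
  have hroot : ∀ i, ∃ t : Fin 2 → K, t ≠ 0 ∧ MvPolynomial.eval t (f.form i) = 0 := by
    intro i
    obtain ⟨a, b, c, h⟩ := (f.homogeneous i).exists_eq_quadratic
    by_cases ha : a = 0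
    · exact ⟨![1, 0], fun h => one_ne_zero (congrFun h 0), by simp [h, ha]⟩
    · obtain ⟨s, hs⟩ := IsAlgClosed.exists_root (Polynomial.C a * Polynomial.X ^ 2 +
        Polynomial.C b * Polynomial.X + Polynomial.C c) (by
          rw [Polynomial.degree_quadratic ha]; norm_num)
      refine ⟨![s, 1], fun h => one_ne_zero (congrFun h 1), ?_⟩
      simpa [h] using hs
  rcases (show y 0 ≠ 0 ∨ y 1 ≠ 0 by
    by_contra! h; exact hy0 (by funext i; fin_cases i <;> simp [h.1, h.2])) with h | h
  · obtain ⟨t, ht, ht0⟩ := hroot 0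
    obtain ⟨i, hi⟩ := f.noCommonZero t ht
    have := heval t
    rw [ht0, mul_zero, eq_comm, mul_eq_zero] at this
    fin_cases i
    · exact hi ht0
    · exact hi (this.resolve_left h)
  · obtain ⟨t, ht, ht1⟩ := hroot 1
    obtain ⟨i, hi⟩ := f.noCommonZero t ht
    have := heval t
    rw [ht1, mul_zero, mul_eq_zero] at this
    fin_cases i
    · exact hi (this.resolve_left h)
    · exact hi ht1

/-- The points that are alone in their fibre. -/
def totallyRamified {d : ℕ} (f : RatMap K d) : Set (ProjLine K) :=
  {P | ∀ Q, f.map Q = f.map P → Q = P}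

open Classical in
/-- The ramification index of a quadratic map is two at the points that are alone in their fibre,
and one elsewhere. -/
theorem ramificationIndex_quadratic [IsAlgClosed K] (f : RatMap K 2) (P : ProjLine K) :
    f.ramificationIndex P = if P ∈ f.totallyRamified then 2 else 1 := by
  obtain ⟨z, hz0, hz⟩ := f.exists_linForm_mul_linForm P.rep_nonzero
  set x := P.rep with hx
  have hx0 : x ≠ 0 := P.rep_nonzero
  have hP : P = Projectivization.mk K x hx0 := P.mk_rep.symm
  -- The fibre through `P` is `{P, [z]}`, so ramification at `P` means `[z] = P`.
  have hfib : ∀ t (ht : t ≠ 0), f.map (Projectivization.mk K t ht) = f.map P ↔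
      (Projectivization.mk K t ht = P ∨ Projectivization.mk K t ht = Projectivization.mk K z hz0) := by
    intro t ht
    rw [hP, map_mk, map_mk, mk_eq_mk_iff_fin_two, mk_eq_mk_iff_fin_two, mk_eq_mk_iff_fin_two]
    have := congrArg (MvPolynomial.eval t) hz
    simp only [map_sub, map_mul, MvPolynomial.eval_C, eval_linForm] at this
    have e : f.lift t 0 * f.lift x 1 - f.lift t 1 * f.lift x 0 =
        (x 1 * t 0 - x 0 * t 1) * (z 1 * t 0 - z 0 * t 1) := by
      rw [← this]
      simp only [lift]
      ring
    rw [← sub_eq_zero, e, mul_eq_zero, sub_eq_zero, sub_eq_zero, mul_comm (x 1), mul_comm (x 0),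
      mul_comm (z 1), mul_comm (z 0)]
  have hmem : P ∈ f.totallyRamified ↔ Projectivization.mk K z hz0 = P := by
    constructor
    · intro h
      exact h _ ((hfib z hz0).mpr (Or.inr rfl))
    · intro h Q hQ
      induction Q using Projectivization.ind with | h t ht =>
      rcases (hfib t ht).mp hQ with h1 | h1
      · exact h1
      · exact h1.trans h
  have hlx : linForm x ≠ 0 := linForm_ne_zero hx0
  have hxx : MvPolynomial.eval x (linForm x) = 0 := by rw [eval_linForm]; ring
  rw [ramificationIndex, hz]
  split_ifs with h
  · obtain ⟨c, hc⟩ := (mk_eq_mk_iff' K _ _ hz0 hx0).mp ((hmem.mp h).trans hP)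
    have hc0 : c ≠ 0 := by
      rintro rfl
      exact hz0 (by rw [← hc, zero_smul])
    rw [← hc, linForm_smul]
    refine multiplicity_eq_of_dvd_of_not_dvd ⟨MvPolynomial.C c, by ring⟩ ?_
    rintro ⟨q, hq⟩
    have : MvPolynomial.C c = linForm x * q := by
      apply mul_left_cancel₀ (pow_ne_zero 2 hlx)
      linear_combination hq
    have := congrArg (MvPolynomial.eval x) this
    rw [map_mul, hxx, zero_mul, MvPolynomial.eval_C] at this
    exact hc0 this
  · refine multiplicity_eq_of_dvd_of_not_dvd ⟨linForm z, by ring⟩ ?_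
    rintro ⟨q, hq⟩
    have : linForm z = linForm x * q := by
      apply mul_left_cancel₀ hlx
      linear_combination hq
    have := congrArg (MvPolynomial.eval x) this
    rw [map_mul, hxx, zero_mul, eval_linForm] at this
    apply h
    rw [hmem, hP, mk_eq_mk_iff_fin_two]
    linear_combination -this

end Ramification

/-! ### The normal form as a morphism of the projective line -/

section NormalForm

variable {K : Type*} [Field K]

/-- The homogeneous lift `(X (X + λ Y), Y (μ X + Y))`. -/
noncomputable def normalForm (lam mu : K) (h : lam * mu ≠ 1) : RatMap K 2 where
  form := ![MvPolynomial.X 0 * (MvPolynomial.X 0 + MvPolynomial.C lam * MvPolynomial.X 1),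
    MvPolynomial.X 1 * (MvPolynomial.C mu * MvPolynomial.X 0 + MvPolynomial.X 1)]
  homogeneous := by
    have hC (c : K) (i : Fin 2) :
        (MvPolynomial.C c * MvPolynomial.X i : MvPolynomial (Fin 2) K).IsHomogeneous 1 := by
      simpa using (MvPolynomial.isHomogeneous_C (Fin 2) c).mul (MvPolynomial.isHomogeneous_X K i)
    have hX := MvPolynomial.isHomogeneous_X (σ := Fin 2) K
    intro i
    fin_cases i
    · exact (hX 0).mul ((hX 0).add (hC lam 1))
    · exact (hX 1).mul ((hC mu 0).add (hX 1))
  noCommonZero := by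
    intro x hx
    by_contra! hcon
    have h0 := hcon 0
    have h1 := hcon 1
    simp at h0 h1
    have hD : 1 - lam * mu ≠ 0 := sub_ne_zero.mpr h.symm
    apply hx
    funext i
    fin_cases i
    · rcases h0 with h0 | h0
      · simpa using h0
      · rcases h1 with h1 | h1
        · simpa [h1] using h0
        · have : (1 - lam * mu) * x 0 = 0 := by linear_combination h0 - lam * h1
          simpa [hD] using this
    · rcases h1 with h1 | h1
      · simpa using h1
      · rcases h0 with h0 | h0
        · simpa [h0] using h1
        · have : (1 - lam * mu) * x 1 = 0 := by linear_combination h1 - mu * h0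
          simpa [hD] using this

variable {lam mu : K} (h : lam * mu ≠ 1)

theorem normalForm_lift (x : Fin 2 → K) :
    (normalForm lam mu h).lift x = ![x 0 * (x 0 + lam * x 1), x 1 * (mu * x 0 + x 1)] := by
  funext i
  fin_cases i <;> simp [lift, normalForm]

theorem mk_mem_totallyRamified_normalForm_iff {x : Fin 2 → K} (hx : x ≠ 0) :
    Projectivization.mk K x hx ∈ (normalForm lam mu h).totallyRamified ↔
      mu * x 0 ^ 2 + 2 * x 0 * x 1 + lam * x 1 ^ 2 = 0 := by
  have hD : 1 - lam * mu ≠ 0 := sub_ne_zero.mpr h.symm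
  -- This vector represents the other point of the fibre; the critical equation says that it is
  -- proportional to `x`.
  have hz : ![x 0 + lam * x 1, -(mu * x 0 + x 1)] ≠ 0 := by
    intro hz
    have h0 : x 0 + lam * x 1 = 0 := congrFun hz 0
    have h1 : -(mu * x 0 + x 1) = 0 := congrFun hz 1
    have e0 : (1 - lam * mu) * x 0 = 0 := by linear_combination h0 + lam * h1
    have e1 : (1 - lam * mu) * x 1 = 0 := by linear_combination -h1 - mu * h0
    exact hx (by funext i; fin_cases i <;> simp_all)
  have hfib : ∀ t (ht : t ≠ 0), (normalForm lam mu h).map (Projectivization.mk K t ht) =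
      (normalForm lam mu h).map (Projectivization.mk K x hx) ↔
      (x 1 * t 0 - x 0 * t 1) * ((mu * x 0 + x 1) * t 0 + (x 0 + lam * x 1) * t 1) = 0 := by
    intro t ht
    rw [map_mk, map_mk, mk_eq_mk_iff_fin_two, normalForm_lift, normalForm_lift, ← sub_eq_zero]
    simp only [Matrix.cons_val_zero, Matrix.cons_val_one]
    refine iff_of_eq (congrArg (· = 0) ?_)
    ring
  constructor
  · intro hmem
    have := hmem (Projectivization.mk K _ hz) ((hfib _ hz).mpr (by simp; right; ring))
    rw [mk_eq_mk_iff_fin_two] at this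
    simp at this
    linear_combination this
  · intro hcrit Q hQ
    induction Q using Projectivization.ind with | h t ht =>
    rw [hfib, mul_eq_zero] at hQ
    rw [mk_eq_mk_iff_fin_two]
    rcases hQ with hQ | hQ
    · linear_combination hQ
    · by_contra hne
      have hne' : t 0 * x 1 - t 1 * x 0 ≠ 0 := sub_ne_zero.mpr hne
      have e0 : (t 0 * x 1 - t 1 * x 0) * (mu * x 0 + x 1) = 0 := by
        linear_combination x 1 * hQ - t 1 * hcrit
      have e1 : (t 0 * x 1 - t 1 * x 0) * (x 0 + lam * x 1) = 0 := by
        linear_combination -x 0 * hQ + t 0 * hcrit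
      have f0 := (mul_eq_zero.mp e0).resolve_left hne'
      have f1 := (mul_eq_zero.mp e1).resolve_left hne'
      exact hz (by rw [f0, f1]; simp)

end NormalForm

end RatMap

/-! ### The Weil height on the projective line and canonical heights -/

open NumberField

theorem weilHeight_mk {x : Fin 2 → Qbar} (hx : x ≠ 0) :
    weilHeight (Projectivization.mk Qbar x hx) = absLogHeight₁ (x 0 / x 1) := by
  unfold weilHeight
  simp only [OnePoint.equivProjectivization_symm_apply_mk]
  by_cases h : x 1 = 0
  · simp [h, absLogHeight₁_zero]
  · simp [h, div_eq_inv_mul]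

theorem weilHeight_nonneg (P : ProjLine Qbar) : 0 ≤ weilHeight P := by
  induction P using Projectivization.ind with | h x hx =>
  rw [weilHeight_mk]
  exact absLogHeight₁_nonneg _

theorem exists_weilHeight_smul_le (A : GL (Fin 2) Qbar) :
    ∃ C, ∀ P : ProjLine Qbar, weilHeight (A • P) ≤ C + weilHeight P := by
  refine ⟨Real.log 2 + (absLogHeight₁ (A 0 0) + absLogHeight₁ (A 0 1) + absLogHeight₁ (A 1 0) +
    absLogHeight₁ (A 1 1)), fun P => ?_⟩
  induction P using Projectivization.ind with | h x hx =>
  rw [Projectivization.smul_mk, weilHeight_mk, weilHeight_mk]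
  convert absLogHeight₁_moebius_le (A 0 0) (A 0 1) (A 1 0) (A 1 1) (x 0) (x 1) using 3 <;>
    simp [Units.smul_def, Matrix.mulVec, dotProduct, Fin.sum_univ_two]

theorem exists_abs_weilHeight_smul_sub_le (A : GL (Fin 2) Qbar) :
    ∃ C, ∀ P : ProjLine Qbar, |weilHeight (A • P) - weilHeight P| ≤ C := by
  obtain ⟨C₁, h₁⟩ := exists_weilHeight_smul_le A
  obtain ⟨C₂, h₂⟩ := exists_weilHeight_smul_le A⁻¹
  refine ⟨max C₁ C₂, fun P => abs_le.mpr ⟨?_, ?_⟩⟩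
  · have := h₂ (A • P)
    rw [inv_smul_smul] at this
    linarith [le_max_right C₁ C₂]
  · linarith [h₁ P, le_max_left C₁ C₂]

/-- Tate's limiting argument. -/
theorem exists_tendsto_div_two_pow {a : ℕ → ℝ} {C : ℝ} (h : ∀ n, |a (n + 1) - 2 * a n| ≤ C) :
    ∃ L, Filter.Tendsto (fun n => a n / 2 ^ n) Filter.atTop (nhds L) ∧ |a 0 - L| ≤ C := by
  have hd : ∀ n, dist (a n / 2 ^ n) (a (n + 1) / 2 ^ (n + 1)) ≤ C / 2 / 2 ^ n := by
    intro n
    rw [dist_comm, Real.dist_eq]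
    have e : a (n + 1) / 2 ^ (n + 1) - a n / 2 ^ n = (a (n + 1) - 2 * a n) / (2 * 2 ^ n) := by
      rw [pow_succ]
      field_simp
    rw [e, abs_div, abs_of_pos (by positivity : (0 : ℝ) < 2 * 2 ^ n), div_div]
    gcongr
    exact h n
  obtain ⟨L, hL⟩ := cauchySeq_tendsto_of_complete (cauchySeq_of_le_geometric_two hd)
  refine ⟨L, hL, ?_⟩
  have := dist_le_of_le_geometric_two_of_tendsto₀ hd hL
  rwa [pow_zero, div_one, Real.dist_eq] at this

namespace RatMap

section CanonicalHeight

theorem canonicalHeight_eq_of_tendsto {d : ℕ} {f : RatMap Qbar d} {P : ProjLine Qbar} {L : ℝ}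
    (h : Filter.Tendsto (fun n : ℕ => weilHeight (f.map^[n] P) / (d : ℝ) ^ n) Filter.atTop
      (nhds L)) : f.canonicalHeight P = L :=
  h.limUnder_eq

/-- A constant bounding the difference of `h ∘ f` and `2 h` for the normal form. -/
noncomputable def heightConst (lam mu : Qbar) : ℝ :=
  5 * (absLogHeight₁ lam + absLogHeight₁ mu) + 4 * Real.log 2

variable {lam mu : Qbar} (h : lam * mu ≠ 1)

theorem abs_weilHeight_normalForm_sub_le (P : ProjLine Qbar) :
    |weilHeight ((normalForm lam mu h).map P) - 2 * weilHeight P| ≤ heightConst lam mu := by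
  induction P using Projectivization.ind with | h x hx =>
  rw [map_mk, weilHeight_mk, weilHeight_mk, normalForm_lift]
  refine abs_absLogHeight₁_quadratic_sub_le h fun hx' => hx ?_
  funext i
  fin_cases i
  · exact congrFun hx' 0
  · exact congrFun hx' 1

theorem tendsto_canonicalHeight_normalForm (P : ProjLine Qbar) :
    Filter.Tendsto (fun n : ℕ => weilHeight ((normalForm lam mu h).map^[n] P) / 2 ^ n) Filter.atTop
      (nhds ((normalForm lam mu h).canonicalHeight P)) ∧
    weilHeight P ≤ (normalForm lam mu h).canonicalHeight P + heightConst lam mu := by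
  obtain ⟨L, hL, hC⟩ := exists_tendsto_div_two_pow
    (a := fun n => weilHeight ((normalForm lam mu h).map^[n] P)) (C := heightConst lam mu)
    (fun n => by
      rw [Function.iterate_succ_apply']
      exact abs_weilHeight_normalForm_sub_le h _)
  have : (normalForm lam mu h).canonicalHeight P = L :=
    canonicalHeight_eq_of_tendsto (by simpa using hL)
  rw [this]
  rw [Function.iterate_zero_apply] at hC
  exact ⟨hL, by linarith [(abs_le.mp hC).2]⟩

theorem canonicalHeight_iterate_normalForm (P : ProjLine Qbar) (N : ℕ) :
    (normalForm lam mu h).canonicalHeight ((normalForm lam mu h).map^[N] P) =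
      2 ^ N * (normalForm lam mu h).canonicalHeight P := by
  refine tendsto_nhds_unique (tendsto_canonicalHeight_normalForm h _).1 ?_
  have := (((tendsto_canonicalHeight_normalForm h P).1.comp
    (Filter.tendsto_add_atTop_nat N)).const_mul ((2 : ℝ) ^ N))
  refine this.congr fun n => ?_
  rw [Function.comp_apply, Function.iterate_add_apply, pow_add]
  field_simp

theorem weilHeight_iterate_normalForm_le (P : ProjLine Qbar) (N : ℕ) :
    weilHeight ((normalForm lam mu h).map^[N] P) ≤
      2 ^ N * (normalForm lam mu h).canonicalHeight P + heightConst lam mu := by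
  rw [← canonicalHeight_iterate_normalForm h]
  exact (tendsto_canonicalHeight_normalForm h _).2

/-- At a pole the affine formula yields `0` by `a / 0 = 0`, while the true orbit reaches `[0 : 1]`.
Both are fixed from then on and have height 0, so the heights still agree. -/
theorem weilHeight_iterate_normalForm_one_mk (w : Qbar) (hw : ![1, w] ≠ 0) (n : ℕ) :
    weilHeight ((normalForm lam mu h).map^[n] (Projectivization.mk Qbar ![1, w] hw)) =
      absLogHeight₁ ((quadNormalForm lam mu)^[n] w) := by
  have h01 : (![0, 1] : Fin 2 → Qbar) ≠ 0 := fun h => one_ne_zero (congrFun h 1)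
  have h1u (u : Qbar) : ![1, u] ≠ 0 := fun h => one_ne_zero (congrFun h 0)
  have key : (normalForm lam mu h).map^[n] (Projectivization.mk Qbar ![1, w] hw) =
        Projectivization.mk Qbar ![1, (quadNormalForm lam mu)^[n] w] (h1u _) ∨
      ((normalForm lam mu h).map^[n] (Projectivization.mk Qbar ![1, w] hw) =
        Projectivization.mk Qbar ![0, 1] h01 ∧ (quadNormalForm lam mu)^[n] w = 0) := by
    induction n with
    | zero => exact Or.inl rfl
    | succ n ih =>
      rw [Function.iterate_succ_apply', Function.iterate_succ_apply']
      rcases ih with ih | ⟨ih, ih0⟩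
      · rw [ih]
        set u := (quadNormalForm lam mu)^[n] w
        rw [map_mk]
        simp only [Projectivization.mk_eq_mk_iff_fin_two, normalForm_lift]
        by_cases hd : 1 + lam * u = 0
        · right
          simp [hd, quadNormalForm]
        · left
          simp [quadNormalForm]
          field_simp
      · right
        rw [ih, ih0, map_mk]
        simp only [Projectivization.mk_eq_mk_iff_fin_two, normalForm_lift]
        simp [quadNormalForm]
  rcases key with key | ⟨key, key0⟩
  · rw [key, weilHeight_mk]
    simp [absLogHeight₁_inv]
  · rw [key, key0, weilHeight_mk]
    simp

/-- In the inverse coordinate the two fixed points change places, and so do `λ` and `μ`. -/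
theorem weilHeight_iterate_normalForm_mk_one (z : Qbar) (hz : ![z, 1] ≠ 0) (n : ℕ) :
    weilHeight ((normalForm lam mu h).map^[n] (Projectivization.mk Qbar ![z, 1] hz)) =
      absLogHeight₁ ((quadNormalForm mu lam)^[n] z) := by
  have h10 : (![1, 0] : Fin 2 → Qbar) ≠ 0 := fun h => one_ne_zero (congrFun h 0)
  have hu1 (u : Qbar) : ![u, 1] ≠ 0 := fun h => one_ne_zero (congrFun h 1)
  have key : (normalForm lam mu h).map^[n] (Projectivization.mk Qbar ![z, 1] hz) =
        Projectivization.mk Qbar ![(quadNormalForm mu lam)^[n] z, 1] (hu1 _) ∨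
      ((normalForm lam mu h).map^[n] (Projectivization.mk Qbar ![z, 1] hz) =
        Projectivization.mk Qbar ![1, 0] h10 ∧ (quadNormalForm mu lam)^[n] z = 0) := by
    induction n with
    | zero => exact Or.inl rfl
    | succ n ih =>
      rw [Function.iterate_succ_apply', Function.iterate_succ_apply']
      rcases ih with ih | ⟨ih, ih0⟩
      · rw [ih]
        set u := (quadNormalForm mu lam)^[n] z
        rw [map_mk]
        simp only [Projectivization.mk_eq_mk_iff_fin_two, normalForm_lift]
        by_cases hd : 1 + mu * u = 0
        · right
          simp [add_comm (mu * u), hd, quadNormalForm]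
        · left
          simp only [quadNormalForm, Matrix.cons_val_zero, Matrix.cons_val_one]
          rw [mul_div_assoc', eq_div_iff hd]
          ring
      · right
        rw [ih, ih0, map_mk]
        simp only [Projectivization.mk_eq_mk_iff_fin_two, normalForm_lift]
        simp [quadNormalForm]
  rcases key with key | ⟨key, key0⟩
  · rw [key, weilHeight_mk]
    simp
  · rw [key, key0, weilHeight_mk]
    simp

end CanonicalHeight

/-! ### Conjugation invariance and the critical height of the normal form -/

section CritHeight

/-- Describing critical points by their fibres makes conjugation invariance formal, with no
transport of multiplicities. -/
theorem mem_totallyRamified_smul_iff {K : Type*} [Field K] {d : ℕ} {f g : RatMap K d}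
    {A : GL (Fin 2) K} (hA : ∀ P, A • g.map P = f.map (A • P)) (P : ProjLine K) :
    A • P ∈ f.totallyRamified ↔ P ∈ g.totallyRamified := by
  constructor
  · intro hP Q hQ
    have := hP (A • Q) (by rw [← hA, ← hA, hQ])
    exact (MulAction.injective A) this
  · intro hP Q hQ
    have := hP (A⁻¹ • Q) (MulAction.injective A (by
      dsimp only
      rw [hA, hA, smul_inv_smul, hQ]))
    rw [← this, smul_inv_smul]

open Classical in
theorem critHeight_eq_finsum (f : RatMap Qbar 2) :
    f.critHeight = ∑ᶠ P : ProjLine Qbar, if P ∈ f.totallyRamified then f.canonicalHeight P else 0 := by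
  refine finsum_congr fun P => ?_
  have : IsAlgClosed Qbar := AlgebraicClosure.isAlgClosed ℚ
  rw [ramificationIndex_quadratic]
  split_ifs <;> norm_num

/-- A change of coordinate alters heights by a bounded amount, which vanishes after division by `2 ^
n`. This also yields the convergence of the limit for `f`. -/
theorem canonicalHeight_smul_eq {lam mu : Qbar} (h : lam * mu ≠ 1) {f : RatMap Qbar 2}
    {A : GL (Fin 2) Qbar} (hA : ∀ P, A • (normalForm lam mu h).map P = f.map (A • P))
    (P : ProjLine Qbar) :
    f.canonicalHeight (A • P) = (normalForm lam mu h).canonicalHeight P := by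
  refine canonicalHeight_eq_of_tendsto ?_
  obtain ⟨C, hC⟩ := exists_abs_weilHeight_smul_sub_le A
  have hsemi : Function.Semiconj (A • ·) (normalForm lam mu h).map f.map := hA
  have hit (n : ℕ) : f.map^[n] (A • P) = A • (normalForm lam mu h).map^[n] P :=
    ((hsemi.iterate_right n) P).symm
  have hlim := (tendsto_canonicalHeight_normalForm h P).1
  have hzero : Filter.Tendsto (fun n : ℕ =>
      (weilHeight (A • (normalForm lam mu h).map^[n] P) -
        weilHeight ((normalForm lam mu h).map^[n] P)) / 2 ^ n) Filter.atTop (nhds 0) := by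
    have h2 : Filter.Tendsto (fun n : ℕ => C * (1 / 2 : ℝ) ^ n) Filter.atTop (nhds 0) := by
      simpa using (tendsto_pow_atTop_nhds_zero_of_lt_one (by norm_num : (0 : ℝ) ≤ 1 / 2)
        (by norm_num)).const_mul C
    refine squeeze_zero_norm (fun n => ?_) h2
    rw [Real.norm_eq_abs, abs_div, abs_of_pos (by positivity : (0 : ℝ) < 2 ^ n), div_pow, one_pow,
      mul_one_div]
    gcongr
    exact hC _
  have := hlim.add hzero
  rw [add_zero] at this
  refine this.congr fun n => ?_
  rw [hit]
  push_cast
  ring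

theorem critHeight_eq_of_isConj {lam mu : Qbar} (h : lam * mu ≠ 1) {f : RatMap Qbar 2}
    (hf : IsConj f (normalForm lam mu h)) :
    f.critHeight = (normalForm lam mu h).critHeight := by
  classical
  obtain ⟨A, hA⟩ := hf
  rw [critHeight_eq_finsum, critHeight_eq_finsum]
  refine (finsum_eq_of_bijective (A • ·) (MulAction.bijective A) fun P => ?_).symm
  simp only [mem_totallyRamified_smul_iff hA, canonicalHeight_smul_eq h hA]

theorem critHeight_normalForm {lam mu : Qbar} (h : lam * mu ≠ 1) (hlam : lam ≠ 0) {w₁ w₂ : Qbar}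
    (hsum : lam * (w₁ + w₂) = -2) (hprod : lam * (w₁ * w₂) = mu)
    (hw₁ : ![1, w₁] ≠ 0) (hw₂ : ![1, w₂] ≠ 0) :
    (normalForm lam mu h).critHeight =
      (normalForm lam mu h).canonicalHeight (Projectivization.mk Qbar ![1, w₁] hw₁) +
        (normalForm lam mu h).canonicalHeight (Projectivization.mk Qbar ![1, w₂] hw₂) := by
  classical
  -- The discriminant of the critical equation is `4 (1 - λ μ)`.
  have hne : w₁ ≠ w₂ := by
    rintro rfl
    apply h
    have h1 : lam * w₁ = -1 := by
      have : (2 : Qbar) * (lam * w₁ + 1) = 0 := by linear_combination hsum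
      have := (mul_eq_zero.mp this).resolve_left two_ne_zero
      linear_combination this
    rw [← hprod]
    linear_combination (lam * w₁ - 1) * h1
  have hP : Projectivization.mk Qbar ![1, w₁] hw₁ ≠ Projectivization.mk Qbar ![1, w₂] hw₂ := by
    rw [Ne, Projectivization.mk_eq_mk_iff_fin_two]
    simpa using hne.symm
  have hmem : ∀ P, P ∈ (normalForm lam mu h).totallyRamified ↔
      P = Projectivization.mk Qbar ![1, w₁] hw₁ ∨ P = Projectivization.mk Qbar ![1, w₂] hw₂ := by
    intro P
    induction P using Projectivization.ind with | h x hx =>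
    rw [mk_mem_totallyRamified_normalForm_iff, Projectivization.mk_eq_mk_iff_fin_two,
      Projectivization.mk_eq_mk_iff_fin_two]
    have e : mu * x 0 ^ 2 + 2 * x 0 * x 1 + lam * x 1 ^ 2 =
        lam * ((x 0 * w₁ - x 1) * (x 0 * w₂ - x 1)) := by
      linear_combination -x 0 ^ 2 * hprod + x 0 * x 1 * hsum
    rw [e, mul_eq_zero, or_iff_right hlam, mul_eq_zero, sub_eq_zero, sub_eq_zero]
    simp
  rw [critHeight_eq_finsum, finsum_eq_sum_of_support_subset
    (s := {Projectivization.mk Qbar ![1, w₁] hw₁, Projectivization.mk Qbar ![1, w₂] hw₂}),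
    Finset.sum_pair hP]
  · simp [hmem]
  · intro P hPs
    rw [Function.mem_support] at hPs
    by_contra hcon
    apply hPs
    rw [if_neg]
    rw [hmem]
    simpa using hcon

end CritHeight

end RatMap

/-! ### Reduction to the normal form -/

namespace RatMap

section Reduction

variable {K : Type*} [Field K]

theorem lift_add_smul (f : RatMap K 2) (x v : Fin 2 → K) (s t : K) :
    f.lift (s • x + t • v) = s ^ 2 • f.lift x + (s * t) • f.diff x v + t ^ 2 • f.lift v := by
  funext i
  obtain ⟨a, b, c, h⟩ := (f.homogeneous i).exists_eq_quadratic
  simp only [lift, diff, Pi.add_apply, Pi.smul_apply, smul_eq_mul, h, Fin.sum_univ_two]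
  simp [Derivation.leibniz, Derivation.leibniz_pow, MvPolynomial.pderiv_X]
  ring

theorem diff_self (f : RatMap K 2) (x : Fin 2 → K) : f.diff x x = (2 : K) • f.lift x := by
  funext i
  obtain ⟨a, b, c, h⟩ := (f.homogeneous i).exists_eq_quadratic
  simp only [lift, diff, Pi.smul_apply, smul_eq_mul, h, Fin.sum_univ_two]
  simp [Derivation.leibniz, Derivation.leibniz_pow, MvPolynomial.pderiv_X]
  ring

theorem diff_add_smul {d : ℕ} (f : RatMap K d) (x v w : Fin 2 → K) (s t : K) :
    f.diff x (s • v + t • w) = s • f.diff x v + t • f.diff x w := by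
  funext i
  simp only [diff, Pi.add_apply, Pi.smul_apply, smul_eq_mul, Fin.sum_univ_two]
  ring

theorem exists_eq_smul_add_smul {x v : Fin 2 → K} (h : LinearIndependent K ![x, v])
    (y : Fin 2 → K) : ∃ p q : K, y = p • x + q • v := by
  have hspan := h.span_eq_top_of_card_eq_finrank (by simp)
  have hy : y ∈ Submodule.span K (Set.range ![x, v]) := by rw [hspan]; trivial
  rw [Matrix.range_cons, Matrix.range_cons, Matrix.range_empty, Set.union_empty,
    Set.singleton_union, Submodule.mem_span_pair] at hy
  obtain ⟨p, q, hpq⟩ := hy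
  exact ⟨p, q, hpq.symm⟩

/-- A quadratic map with a fixed point of multiplier `λ ≠ 1` has a second fixed point. -/
theorem exists_second_fixedPoint [IsAlgClosed K] {f : RatMap K 2} {lam : K} (hlam : lam ≠ 1)
    {P : ProjLine K} (hP : f.IsFixedPointWithMultiplier P lam) :
    ∃ (x w : Fin 2 → K) (c t : K), c ≠ 0 ∧ LinearIndependent K ![w, x] ∧
      f.lift x = c • x ∧ f.lift w = c • w ∧ f.diff x w = (lam * c) • w + t • x := by
  obtain ⟨x, hx, v, c, t, -, hli, hfx, hdv⟩ := hP
  have hc : c ≠ 0 := by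
    rintro rfl
    exact f.lift_ne_zero hx (by rw [hfx, zero_smul])
  obtain ⟨p, q, hv⟩ := exists_eq_smul_add_smul hli (f.lift v)
  have hA : c * (1 - lam) ≠ 0 := mul_ne_zero hc (sub_ne_zero.mpr hlam.symm)
  -- This equation says that `[s x + v]` is fixed; `λ ≠ 1` makes it truly quadratic.
  obtain ⟨s, hs⟩ := IsAlgClosed.exists_root (Polynomial.C (c * (1 - lam)) * Polynomial.X ^ 2 +
    Polynomial.C (t - q) * Polynomial.X + Polynomial.C p) (by
      rw [Polynomial.degree_quadratic hA]; norm_num)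
  have hs' : c * (1 - lam) * s ^ 2 + (t - q) * s + p = 0 := by simpa using hs
  have hli' : LinearIndependent K ![s • x + v, x] := by
    rw [LinearIndependent.pair_iff] at hli ⊢
    intro a b hab
    have := hli (a * s + b) a (by rw [← hab]; module)
    refine ⟨this.2, ?_⟩
    simpa [this.2] using this.1
  have hw0 : s • x + v ≠ 0 := by simpa using hli'.ne_zero 0
  set d := lam * c * s + q with hd
  have hfw : f.lift (s • x + v) = d • (s • x + v) := by
    have h1 := f.lift_add_smul x v s 1
    rw [one_smul, hfx, hdv, hv] at h1
    rw [h1]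
    have hp : p = -(c * (1 - lam) * s ^ 2 + (t - q) * s) := by linear_combination hs'
    rw [hp, hd]
    module
  have hd0 : d ≠ 0 := by
    intro h0
    exact f.lift_ne_zero hw0 (by rw [hfw, h0, zero_smul])
  -- As the lift has degree 2, rescaling by `c / d` changes the eigenvalue `d` to `c`.
  refine ⟨x, (c / d) • (s • x + v), c, c / d * (2 * s * c + t - lam * c * s), hc, ?_, hfx, ?_, ?_⟩
  · rw [LinearIndependent.pair_iff] at hli' ⊢
    intro a b hab
    have := hli' (a * (c / d)) b (by rw [← hab]; module)
    refine ⟨?_, this.2⟩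
    simpa [hc, hd0] using this.1
  · rw [lift_smul, hfw]
    simp only [smul_smul]
    congr 1
    field_simp
  · have h1 := f.diff_add_smul x x v (c / d * s) (c / d)
    rw [diff_self, hfx, hdv] at h1
    rw [show (c / d) • (s • x + v) = (c / d * s) • x + (c / d) • v by module, h1]
    module

/-- A quadratic map with a fixed point of multiplier `λ ≠ 1` is conjugate to a normal form. -/
theorem exists_isConj_normalForm [IsAlgClosed K] {f : RatMap K 2} {lam : K} (hlam : lam ≠ 1)
    {P : ProjLine K} (hP : f.IsFixedPointWithMultiplier P lam) :
    ∃ (mu : K) (h : lam * mu ≠ 1), IsConj f (normalForm lam mu h) := by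
  obtain ⟨x, w, c, t, hc, hli, hfx, hfw, hdw⟩ := exists_second_fixedPoint hlam hP
  have hlift (a b : K) : f.lift (a • w + b • x) =
      c • ((a * (a + lam * b)) • w + (b * (t / c * a + b)) • x) := by
    rw [add_comm, lift_add_smul, hfx, hfw, hdw]
    have ht : t = c * (t / c) := by field_simp
    conv_lhs => rw [ht]
    module
  -- Otherwise the lift would kill `-λ w + x`.
  have hmu : lam * (t / c) ≠ 1 := by
    intro h1
    have h0 : (-lam) • w + (1 : K) • x ≠ 0 := by
      intro h0
      exact one_ne_zero (LinearIndependent.pair_iff.mp hli _ _ h0).2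
    apply f.lift_ne_zero h0
    rw [hlift, show (1 : K) * (t / c * -lam + 1) = 0 by linear_combination -h1]
    simp
  let M : Matrix (Fin 2) (Fin 2) K := !![w 0, x 0; w 1, x 1]
  have hM (a b : K) : M.mulVec ![a, b] = a • w + b • x := by
    funext i
    fin_cases i <;> simp [M, Matrix.mulVec, dotProduct, mul_comm]
  have hdet : M.det ≠ 0 := by
    intro h0
    obtain ⟨u, hu, hu0⟩ := Matrix.exists_mulVec_eq_zero_iff.mpr h0
    rw [show u = ![u 0, u 1] by funext i; fin_cases i <;> rfl, hM] at hu0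
    have := LinearIndependent.pair_iff.mp hli _ _ hu0
    exact hu (by funext i; fin_cases i <;> simp [this.1, this.2])
  let A : GL (Fin 2) K := Matrix.GeneralLinearGroup.mkOfDetNeZero M hdet
  have hA (y : Fin 2 → K) : A • y = y 0 • w + y 1 • x := by
    rw [← hM, show ![y 0, y 1] = y by funext i; fin_cases i <;> rfl]
    rfl
  refine ⟨t / c, hmu, A, fun Q => ?_⟩
  induction Q using Projectivization.ind with | h y hy =>
  rw [map_mk, Projectivization.smul_mk, Projectivization.smul_mk, map_mk,
    Projectivization.mk_eq_mk_iff']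
  refine ⟨c⁻¹, ?_⟩
  rw [hA, hA, hlift, smul_smul, inv_mul_cancel₀ hc, one_smul, normalForm_lift]
  rfl

end Reduction

/-! ### Comparison of multipliers with the critical height, and the limit -/

section Bounds

variable {lam mu : Qbar} (h : lam * mu ≠ 1)

theorem exists_critical_coordinates (hlam : lam ≠ 0) (mu : Qbar) :
    ∃ w₁ w₂ : Qbar, lam * (w₁ + w₂) = -2 ∧ lam * (w₁ * w₂) = mu := by
  have : IsAlgClosed Qbar := AlgebraicClosure.isAlgClosed ℚ
  obtain ⟨s, hs⟩ := IsAlgClosed.exists_root (Polynomial.C lam * Polynomial.X ^ 2 +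
    Polynomial.C 2 * Polynomial.X + Polynomial.C mu) (by
      rw [Polynomial.degree_quadratic hlam]; norm_num)
  have hs' : lam * s ^ 2 + 2 * s + mu = 0 := by simpa using hs
  refine ⟨s, -2 / lam - s, by field_simp; ring, ?_⟩
  have : lam * (s * (-2 / lam - s)) = -2 * s - lam * s ^ 2 := by
    field_simp
  rw [this]
  linear_combination -hs'

/-- The critical height bounds the heights of the multipliers of the two fixed points. -/
theorem mul_absLogHeight₁_le_critHeight (hlam : lam ≠ 0) (N : ℕ) :
    N * (absLogHeight₁ lam - Real.log 12) ≤
        2 ^ (N + 1) * (normalForm lam mu h).critHeight + 2 * heightConst lam mu ∧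
      N * (absLogHeight₁ mu - Real.log 12) ≤
        2 ^ (N + 1) * (normalForm lam mu h).critHeight + 2 * heightConst lam mu := by
  obtain ⟨w₁, w₂, hsum, hprod⟩ := exists_critical_coordinates hlam mu
  have h1u (u : Qbar) : ![1, u] ≠ 0 := fun h => one_ne_zero (congrFun h 0)
  have hu1 (u : Qbar) : ![u, 1] ≠ 0 := fun h => one_ne_zero (congrFun h 1)
  have hcrit := critHeight_normalForm h hlam hsum hprod (h1u w₁) (h1u w₂)
  have b₁ := weilHeight_iterate_normalForm_le h (Projectivization.mk Qbar ![1, w₁] (h1u _)) (N + 1)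
  have b₂ := weilHeight_iterate_normalForm_le h (Projectivization.mk Qbar ![1, w₂] (h1u _)) (N + 1)
  have hbound : weilHeight ((normalForm lam mu h).map^[N + 1]
        (Projectivization.mk Qbar ![1, w₁] (h1u _))) +
      weilHeight ((normalForm lam mu h).map^[N + 1]
        (Projectivization.mk Qbar ![1, w₂] (h1u _))) ≤
      2 ^ (N + 1) * (normalForm lam mu h).critHeight + 2 * heightConst lam mu := by
    rw [hcrit]
    linarith
  refine ⟨le_trans ?_ hbound, le_trans ?_ hbound⟩
  · rw [weilHeight_iterate_normalForm_one_mk, weilHeight_iterate_normalForm_one_mk]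
    exact mul_absLogHeight₁_le hlam h hsum hprod N
  · by_cases hmu : mu = 0
    · have hmu0 : absLogHeight₁ mu = 0 := by rw [hmu, absLogHeight₁_zero]
      rw [hmu0]
      refine le_trans (mul_nonpos_of_nonneg_of_nonpos N.cast_nonneg ?_)
        (add_nonneg (weilHeight_nonneg _) (weilHeight_nonneg _))
      have : 0 ≤ Real.log 12 := Real.log_nonneg (by norm_num)
      linarith
    · have hw₁ : w₁ ≠ 0 := by
        rintro rfl
        exact hmu (by rw [← hprod]; ring)
      have hw₂ : w₂ ≠ 0 := by
        rintro rfl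
        exact hmu (by rw [← hprod]; ring)
      have e (w : Qbar) (hw : w ≠ 0) : Projectivization.mk Qbar ![1, w] (h1u _) =
          Projectivization.mk Qbar ![w⁻¹, 1] (hu1 _) := by
        rw [Projectivization.mk_eq_mk_iff_fin_two]
        simp [hw]
      -- The critical points have inverse coordinates with sum `-2 / μ` and product `λ / μ`, so the
      -- first estimate applies with `λ` and `μ` exchanged.
      rw [e w₁ hw₁, e w₂ hw₂, weilHeight_iterate_normalForm_mk_one,
        weilHeight_iterate_normalForm_mk_one]
      refine NumberField.mul_absLogHeight₁_le hmu (by rwa [mul_comm]) ?_ ?_ N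
      · rw [← hsum, ← hprod]
        field_simp
        ring
      · rw [← hprod]
        field_simp

end Bounds

end RatMap

/-- The difficulty is that `m` depends on `ε`. For a fixed `N₀ ≥ α + 1` the second inequality
absorbs `α m` and bounds `m` uniformly; the first then contradicts `a > L` for large `N`. -/
theorem le_of_forall_mul_sub_le {a L α β : ℝ} (hα : 0 ≤ α)
    (hex : ∀ ε > 0, ∃ m e : ℝ, e < ε ∧ ∀ N : ℕ,
      N * (a - L) ≤ 2 ^ (N + 1) * e + (α * (a + m) + β) ∧
      N * (m - L) ≤ 2 ^ (N + 1) * e + (α * (a + m) + β)) : a ≤ L := by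
  obtain ⟨N₀, hN₀⟩ := exists_nat_ge (α + 1)
  by_contra! hlt
  set M := max 0 (N₀ * L + 1 + α * a + β)
  obtain ⟨N, hN⟩ := exists_nat_gt ((1 + (α * (a + M) + β)) / (a - L))
  -- `M` and `N` are fixed before `m` is known; one small `e` must serve both `N₀` and `N`.
  obtain ⟨m, e, he, hb⟩ := hex (min (1 / 2 ^ (N₀ + 1)) (1 / 2 ^ (N + 1))) (by positivity)
  have e₀ : 2 ^ (N₀ + 1) * e ≤ 1 := by
    have := he.le.trans (min_le_left _ _)
    rwa [le_div_iff₀' (by positivity)] at this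
  have e₁ : 2 ^ (N + 1) * e ≤ 1 := by
    have := he.le.trans (min_le_right _ _)
    rwa [le_div_iff₀' (by positivity)] at this
  have hm : m ≤ M := by
    by_cases hm0 : m ≤ 0
    · exact hm0.trans (le_max_left _ _)
    · refine le_trans ?_ (le_max_right _ _)
      have := (hb N₀).2
      nlinarith
  have h1 := (hb N).1
  rw [div_lt_iff₀ (by linarith)] at hN
  have := mul_le_mul_of_nonneg_left hm hα
  nlinarith

theorem mainTheorem6 (lam : Qbar) (hinf : IsGLB (critHeightValues lam) 0) :
    NumberField.absLogHeight₁ lam ≤ Real.log 12 := by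
  have hlog : 0 ≤ Real.log 12 := Real.log_nonneg (by norm_num)
  by_cases h0 : lam = 0
  · rwa [h0, absLogHeight₁_zero]
  by_cases h1 : lam = 1
  · rwa [h1, absLogHeight₁_one]
  have : IsAlgClosed Qbar := AlgebraicClosure.isAlgClosed ℚ
  -- The constants are those of `2 * heightConst lam mu`, one `heightConst` for each critical point.
  refine le_of_forall_mul_sub_le (α := 10) (β := 8 * Real.log 2) (by norm_num) fun ε hε => ?_
  obtain ⟨r, ⟨f, ⟨f', hf', P, hP⟩, rfl⟩, -, hr⟩ := hinf.exists_between hε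
  obtain ⟨mu, hmu, hconj⟩ := RatMap.exists_isConj_normalForm h1 hP
  have hff' : RatMap.IsConj f f' := (RatMap.conjSetoid Qbar 2).symm (Quotient.exact hf')
  have hfg := (RatMap.conjSetoid Qbar 2).trans hff' hconj
  refine ⟨absLogHeight₁ mu, f.critHeight, hr, fun N => ?_⟩
  have key := RatMap.mul_absLogHeight₁_le_critHeight hmu h0 N
  rw [← RatMap.critHeight_eq_of_isConj hmu hfg, RatMap.heightConst] at key
  refine ⟨key.1.trans (le_of_eq ?_), key.2.trans (le_of_eq ?_)⟩ <;> ring
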